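/- Let $m,N\ge 0$ be integers, $M=2^m$, and for $0\le i<M$ let $n_{i,k}\in\{0,1\}$ ($0\le k<m$) be the binary digits of $i$, so that $i=\sum_k n_{i,k}2^k$. Let $\mathbb X=(x_0,\dots,x_{M-1})$ be an alphabet of vectors in $\mathbb R^N$, not all zero, and let $C_0,\dots,C_{m-1}$ be independent bits with $0<P_{C_k}(0)<1$. The transmitted symbol is $X=x_i$ when $C_k=n_{i,k}$ for all $k$; it has probability $P_i=\prod_k P_{C_k}(n_{i,k})$. Write $\mathbb P=(P_0,\dots,P_{M-1})$. The channel output is $Y=H\circ X+Z$ (element-wise product), where $Z$ is Gaussian with mean zero and independent components of variance $N_0/2$ ($N_0>0$), the fading vector $H$ is a random vector in $\mathbb R^N$ with identically distributed (possibly dependent) components, $0<\mathbb E[H^2]<\infty$ where $\mathbb E[H^2]$ denotes the common second moment of the components, and $X,Z,H$ are independent. Let $E_s=\sum_i P_i\|x_i\|^2$ and $\mathrm{SNR}=\mathbb E[H^2]E_s/N_0$, and let $I(\mathrm{SNR})=\sum_{k=0}^{m-1} I(C_k;Y\mid H)$, in bits, be the BICM generalized mutual information as a function of $\mathrm{SNR}\ge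 0$, which is varied by rescaling the alphabet for fixed $N_0$. The constellation $[\mathbb X,\mathbb P]$ is called first-order optimal (FOO) if $\alpha=\log_2 e$, where $\alpha$ is the (right) derivative of $I(\mathrm{SNR})$ at $\mathrm{SNR}=0$. The Hadamard transform of $\mathbb X$ is $\tilde x_j=\frac1M\sum_{i=0}^{M-1}x_i\prod_{k=0}^{m-1}(-1)^{n_{i,k}n_{j,k}}$. Then the following are equivalent: (i) $[\mathbb X,\mathbb P]$ is first-order optimal; (ii) $\mu=\sum_i P_i x_i=0$, and $\tilde x_j=0$ for every $j\in\{0,\dots,M-1\}$ outside $\{0\}\cup\{1,2,4,\dots,M/2\}=\{0\}\cup\{2^k:0\le k<m\}$; (iii) $\mathbb X$ is a linear projection of a hypercube, translated to have zero mean under $\mathbb P$: there is a linear map $L:\mathbb R^m\to\mathbb R^N$ with $x_i=L(q_i)-\sum_j P_jL(q_j)$ for all $i$, where $q_i=((-1)^{n_{i,0}},\dots,(-1)^{n_{i,m-1}})$; (iv) $\mathbb X$ is a translate, by the mean under $\mathbb P$, of an alphabet that is FOO with the uniform distribution: there is an alphabet $\mathbb X'=(x'_0,\dots,x'_{M-1})$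 in $\mathbb R^N$ that is FOO for the uniform input distribution on the same channel, with $x_i=x'_i-\sum_jP_jx'_j$ for all $i$. -/

import Mathlib

open MeasureTheory

noncomputable section

namespace BICM

/-- An input alphabet of `M = 2 ^ m` symbol vectors in `ℝ^N`. -/
abbrev Alphabet (m N : ℕ) : Type := Fin (2 ^ m) → EuclideanSpace ℝ (Fin N)

/-- Bit `k` of the natural binary code of `i` (bit `m - 1` is the most significant one). -/
def nbc {m : ℕ} (i : Fin (2 ^ m)) (k : Fin m) : Bool := i.val.testBit k.val

/-- The probability that the bit `C_k` equals `u`, where `b k` is the probability that it is `0`. -/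
def bitProb {m : ℕ} (b : Fin m → ℝ) (k : Fin m) (u : Bool) : ℝ :=
  if u then 1 - b k else b k

/-- The symbol probability `P_i = ∏_k P_{C_k}(n_{i,k})` (independent bits). -/
def symProb {m : ℕ} (b : Fin m → ℝ) (i : Fin (2 ^ m)) : ℝ :=
  ∏ k : Fin m, bitProb b k (nbc i k)

/-- The bit probabilities of the uniform input distribution. -/
def uniformBits (m : ℕ) : Fin m → ℝ := fun _ => 1 / 2

/-- The mean `μ = ∑ P_i x_i`. -/
def mean {m N : ℕ} (b : Fin m → ℝ) (X : Alphabet m N) : EuclideanSpace ℝ (Fin N) :=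
  ∑ i, symProb b i • X i

/-- The average symbol energy `E_s = ∑ P_i ‖x_i‖²`. -/
def energy {m N : ℕ} (b : Fin m → ℝ) (X : Alphabet m N) : ℝ :=
  ∑ i, symProb b i * ‖X i‖ ^ 2

/-- The Hadamard coefficient `h_{i,j} = ∏_k (-1)^{n_{i,k} n_{j,k}}`. -/
def hadamardCoeff {m : ℕ} (i j : Fin (2 ^ m)) : ℝ :=
  ∏ k : Fin m, (-1 : ℝ) ^ ((nbc i k).toNat * (nbc j k).toNat)

/-- The Hadamard transform `x̃_i = (1 / M) ∑_j h_{i,j} x_j`. -/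
def hadamard {m N : ℕ} (X : Alphabet m N) (i : Fin (2 ^ m)) : EuclideanSpace ℝ (Fin N) :=
  (1 / (2 : ℝ) ^ m) • ∑ j, hadamardCoeff i j • X j

/-- The vertex of the hypercube `{-1, 1}^m` labelled by `i`: coordinate `k` is `(-1)^{n_{i,k}}`. -/
def vertex {m : ℕ} (i : Fin (2 ^ m)) : EuclideanSpace ℝ (Fin m) :=
  WithLp.toLp 2 fun k => (-1 : ℝ) ^ (nbc i k).toNat

/-- The element-wise product `h ∘ x`. -/
def hprod {N : ℕ} (h x : EuclideanSpace ℝ (Fin N)) : EuclideanSpace ℝ (Fin N) :=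
  WithLp.toLp 2 fun n => h n * x n

/-- The transition density `p(y | x, h)` of `Y = h ∘ x + Z`, where `Z` is Gaussian with mean zero
and variance `N0 / 2` in each dimension. -/
def chanPdf {N : ℕ} (N0 : ℝ) (h x y : EuclideanSpace ℝ (Fin N)) : ℝ :=
  1 / (N0 * Real.pi) ^ ((N : ℝ) / 2) * Real.exp (-(‖y - hprod h x‖ ^ 2 / N0))

/-- The density `p(y | h) = ∑_i P_i p(y | x_i, h)` of `Y` given `H = h`. -/
def outPdf {m N : ℕ} (N0 : ℝ) (b : Fin m → ℝ) (X : Alphabet m N)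
    (h y : EuclideanSpace ℝ (Fin N)) : ℝ :=
  ∑ i, symProb b i * chanPdf N0 h (X i) y

/-- The density of `Y` given `H = h` and `C_k = u`. -/
def bitPdf {m N : ℕ} (N0 : ℝ) (b : Fin m → ℝ) (X : Alphabet m N) (k : Fin m) (u : Bool)
    (h y : EuclideanSpace ℝ (Fin N)) : ℝ :=
  ∑ i with nbc i k = u, symProb b i / bitProb b k u * chanPdf N0 h (X i) y

/-- The mutual information `I(C_k; Y | H) = E[log₂ (p(Y | C_k, H) / p(Y | H))]` in bits, where
the fading vector `H` has law `ν` and is independent of the bits and of the noise. -/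
def bitMI {m N : ℕ} (N0 : ℝ) (ν : Measure (EuclideanSpace ℝ (Fin N))) (b : Fin m → ℝ)
    (X : Alphabet m N) (k : Fin m) : ℝ :=
  ∫ h, (∑ u : Bool, bitProb b k u *
    (∫ y, bitPdf N0 b X k u h y *
      Real.logb 2 (bitPdf N0 b X k u h y / outPdf N0 b X h y) ∂volume)) ∂ν

/-- The BICM generalized mutual information `∑_k I(C_k; Y | H)`. -/
def gmi {m N : ℕ} (N0 : ℝ) (ν : Measure (EuclideanSpace ℝ (Fin N))) (b : Fin m → ℝ)
    (X : Alphabet m N) : ℝ :=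
  ∑ k : Fin m, bitMI N0 ν b X k

/-- The BICM generalized mutual information as a function of `SNR = E[H²] E_s / N0`: the noise
level `N0` is fixed and the alphabet is rescaled by the factor `t ≥ 0` with
`E[H²] (t² E_s) / N0 = SNR`. Here `ρ` is the common law of the fading coefficients `H_n`. -/
def gmiAtSNR {m N : ℕ} (N0 : ℝ) (ν : Measure (EuclideanSpace ℝ (Fin N))) (ρ : Measure ℝ)
    (b : Fin m → ℝ) (X : Alphabet m N) (snr : ℝ) : ℝ :=
  gmi N0 ν b fun i => √(snr * N0 / ((∫ a, a ^ 2 ∂ρ) * energy b X)) • X i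

/-- First-order optimality: `α = log₂ e`, where `α` is the derivative of the BICM generalized
mutual information at `SNR = 0` (one-sided, as `SNR ≥ 0`). -/
def IsFOO {m N : ℕ} (N0 : ℝ) (ν : Measure (EuclideanSpace ℝ (Fin N))) (ρ : Measure ℝ)
    (b : Fin m → ℝ) (X : Alphabet m N) : Prop :=
  HasDerivWithinAt (gmiAtSNR N0 ν ρ b X) (Real.logb 2 (Real.exp 1)) (Set.Ici 0) 0

end BICM

end

-- Each equivalence reduces to one condition: `mean b X = 0` and `IsAffineCube X`, that is, the
-- symbol is an affine function of the signs of its bits.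
--
-- Analysis: `I(C_k; Y | H = h)` is the average over the bit of the divergence of the conditional
-- output density from pure noise, minus the divergence of the unconditional output density from
-- pure noise (`bitMI_integrand_eq`). When the shifts of a Gaussian mixture are scaled by `t`, its
-- divergence from the noise is `t² ‖mean shift‖² / N0` to leading order
-- (`tendsto_mixEntropy_smul_div_sq`), because `(1 + x) log (1 + x) - x` behaves like `x² / 2`. So
-- bit `k` contributes the variance of the conditional mean given `C_k`. Averaging over the fading
-- replaces each `h_n²` by the common second moment, and the derivative at zero SNR is `bitEnergy /
-- energy / log 2` (`hasDerivWithinAt_gmiAtSNR`). First-order optimality therefore says `bitEnergy =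
-- energy`.
--
-- Algebra: in `L²` of the symbol law, constants and centred functions of distinct single bits are
-- mutually orthogonal, by independence. Pythagoras (`expect_sq_eq`) writes the energy as squared
-- mean, plus `bitEnergy`, plus the squared residual after projection onto their span. Equality
-- forces zero mean and zero residual. Since a function of one bit is affine in its sign, the span
-- consists of the affine functions of the signs.
--
-- `IsAffineCube` does not involve the bit probabilities and survives translation, which gives the
-- link with the uniform law. In the Hadamard basis, constants and signs are the columns `0` and `2
-- ^ k`, so the condition says that all other coefficients vanish.

noncomputable section

namespace BICM

open Filter Topology RealInnerProductSpace

-- Second-order behaviour of the relative entropy integrand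

section Entropy

/-- The function `(1 + x) log (1 + x) - x`, the integrand of a relative entropy after
subtraction of its mean-zero part. -/
def entropyGap (x : ℝ) : ℝ := (1 + x) * Real.log (1 + x) - x

lemma entropyGap_nonneg {x : ℝ} (hx : 0 < 1 + x) : 0 ≤ entropyGap x := by
  have h := Real.one_sub_inv_le_log_of_pos hx
  have h2 := mul_le_mul_of_nonneg_left h hx.le
  have h3 : (1 + x) * (1 - (1 + x)⁻¹) = x := by field_simp; ring
  unfold entropyGap
  linarith

lemma entropyGap_le_sq {x : ℝ} (hx : 0 < 1 + x) : entropyGap x ≤ x ^ 2 := by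
  have h := Real.log_le_sub_one_of_pos hx
  have h2 := mul_le_mul_of_nonneg_left h hx.le
  unfold entropyGap
  nlinarith

/-- Taylor's formula for `log (1 + x)` to second order; the constant 4 is not sharp, only the cubic
order matters. -/
lemma abs_entropyGap_sub_le {x : ℝ} (hx : |x| ≤ 1 / 2) :
    |entropyGap x - x ^ 2 / 2| ≤ 4 * |x| ^ 3 := by
  have h := Real.abs_log_sub_add_sum_range_le (x := -x) (by rw [abs_neg]; linarith) 2
  simp only [Finset.sum_range_succ, Finset.sum_range_zero, abs_neg, sub_neg_eq_add] at h
  set r := Real.log (1 + x) - x + x ^ 2 / 2 with hr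
  have hr' : |r| ≤ 2 * |x| ^ 3 := by
    have e : r = 0 + (-x) ^ (0 + 1) / ((0 : ℕ) + 1) + (-x) ^ (1 + 1) / ((1 : ℕ) + 1)
        + Real.log (1 + x) := by rw [hr]; push_cast; ring
    rw [e]
    refine h.trans ?_
    rw [div_le_iff₀ (by linarith)]
    have h3 : 0 ≤ |x| ^ 3 * (1 / 2 - |x|) :=
      mul_nonneg (pow_nonneg (abs_nonneg x) 3) (sub_nonneg.2 hx)
    calc |x| ^ (2 + 1) = |x| ^ 3 := rfl
      _ ≤ |x| ^ 3 + 2 * (|x| ^ 3 * (1 / 2 - |x|)) := by linarith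
      _ = 2 * |x| ^ 3 * (1 - |x|) := by ring
  have e : entropyGap x - x ^ 2 / 2 = -(x ^ 3 / 2) + (1 + x) * r := by
    rw [entropyGap, hr]; ring
  have hx3 : |x ^ 3 / 2| = |x| ^ 3 / 2 := by rw [abs_div, abs_pow]; norm_num
  have h1x : |1 + x| ≤ 3 / 2 := by
    have := abs_add_le 1 x
    rw [abs_one] at this
    linarith
  rw [e]
  calc |-(x ^ 3 / 2) + (1 + x) * r| ≤ |-(x ^ 3 / 2)| + |(1 + x) * r| := abs_add_le _ _
    _ = |x| ^ 3 / 2 + |1 + x| * |r| := by rw [abs_neg, hx3, abs_mul]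
    _ ≤ |x| ^ 3 / 2 + 3 / 2 * (2 * |x| ^ 3) := by gcongr
    _ ≤ 4 * |x| ^ 3 := by nlinarith [pow_nonneg (abs_nonneg x) 3]

lemma tendsto_entropyGap_div_sq {f : ℝ → ℝ} {d : ℝ} (hf0 : f 0 = 0) (hf : HasDerivAt f d 0) :
    Tendsto (fun t => entropyGap (f t) / t ^ 2) (𝓝[≠] 0) (𝓝 (d ^ 2 / 2)) := by
  have hslope : Tendsto (fun t => f t / t) (𝓝[≠] 0) (𝓝 d) := by
    have := hf.tendsto_slope
    refine this.congr fun t => ?_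
    simp [slope_def_field, hf0]
  have hf_lim : Tendsto f (𝓝[≠] 0) (𝓝 0) := by
    have := hf.continuousAt.tendsto
    rw [hf0] at this
    exact this.mono_left nhdsWithin_le_nhds
  have hmain : Tendsto (fun t => (f t / t) ^ 2 / 2) (𝓝[≠] 0) (𝓝 (d ^ 2 / 2)) :=
    (hslope.pow 2).div_const 2
  have herr : Tendsto (fun t => entropyGap (f t) / t ^ 2 - (f t / t) ^ 2 / 2)
      (𝓝[≠] 0) (𝓝 0) := by
    -- The cubic error divided by `t²`: two factors `f t` are absorbed by the difference quotient,
    -- and the third tends to zero.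
    have hb : Tendsto (fun t => 4 * (f t / t) ^ 2 * |f t|) (𝓝[≠] 0) (𝓝 0) := by
      have := ((hslope.pow 2).const_mul 4).mul hf_lim.abs
      simpa using this
    refine squeeze_zero_norm' ?_ hb
    have hsmall : ∀ᶠ t in 𝓝[≠] (0 : ℝ), |f t| < 1 / 2 := by
      have := hf_lim.abs
      rw [abs_zero] at this
      exact this.eventually_lt_const (by norm_num)
    filter_upwards [hsmall, self_mem_nhdsWithin] with t ht ht0
    have ht0' : t ≠ 0 := ht0
    have h := abs_entropyGap_sub_le ht.le
    have e : entropyGap (f t) / t ^ 2 - (f t / t) ^ 2 / 2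
        = (entropyGap (f t) - f t ^ 2 / 2) / t ^ 2 := by field_simp
    rw [e, Real.norm_eq_abs, abs_div, abs_of_nonneg (sq_nonneg t),
      div_le_iff₀ (by positivity)]
    refine h.trans (le_of_eq ?_)
    rw [div_pow, pow_succ |f t| 2, sq_abs]
    field_simp
  simpa using herr.add hmain

end Entropy

-- Gaussian noise, its moments and its shifts

section Gaussian

variable {N : ℕ}

/-- The density of the Gaussian noise with variance `N0 / 2` in each dimension. -/
def gaussPdf (N0 : ℝ) (y : EuclideanSpace ℝ (Fin N)) : ℝ :=
  1 / (N0 * Real.pi) ^ ((N : ℝ) / 2) * Real.exp (-(‖y‖ ^ 2 / N0))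

/-- The likelihood ratio at `y` between the noise shifted by `a` and the noise. -/
def likelihood (N0 : ℝ) (a y : EuclideanSpace ℝ (Fin N)) : ℝ :=
  Real.exp ((2 * ⟪a, y⟫ - ‖a‖ ^ 2) / N0)

lemma gaussPdf_pos {N0 : ℝ} (hN0 : 0 < N0) (y : EuclideanSpace ℝ (Fin N)) :
    0 < gaussPdf N0 y := by
  unfold gaussPdf
  have := Real.pi_pos
  positivity

lemma likelihood_pos (N0 : ℝ) (a y : EuclideanSpace ℝ (Fin N)) : 0 < likelihood N0 a y :=
  Real.exp_pos _

lemma gaussPdf_sub (N0 : ℝ) (a y : EuclideanSpace ℝ (Fin N)) :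
    gaussPdf N0 (y - a) = gaussPdf N0 y * likelihood N0 a y := by
  unfold gaussPdf likelihood
  rw [mul_assoc, ← Real.exp_add, norm_sub_sq_real, real_inner_comm]
  congr 2
  ring

lemma integral_gaussPdf {N0 : ℝ} (hN0 : 0 < N0) :
    ∫ y : EuclideanSpace ℝ (Fin N), gaussPdf N0 y = 1 := by
  have h := GaussianFourier.integral_rexp_neg_mul_sq_norm
    (V := EuclideanSpace ℝ (Fin N)) (inv_pos.2 hN0)
  have hpos : 0 < (N0 * Real.pi) ^ ((N : ℝ) / 2) := by
    have := Real.pi_pos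
    positivity
  have e : ∀ y : EuclideanSpace ℝ (Fin N),
      Real.exp (-(‖y‖ ^ 2 / N0)) = Real.exp (-N0⁻¹ * ‖y‖ ^ 2) := by
    intro y; congr 1; ring
  simp only [gaussPdf, e]
  rw [integral_const_mul, h, finrank_euclideanSpace_fin, div_inv_eq_mul, mul_comm Real.pi,
    one_div_mul_cancel hpos.ne']

/-- Half of the Gaussian exponent absorbs the linear term, by completing the square; the other half
stays integrable. This supplies the integrable majorants over `y`. -/
lemma integrable_gaussPdf_mul_exp {N0 : ℝ} (hN0 : 0 < N0) (C : ℝ) :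
    Integrable fun y : EuclideanSpace ℝ (Fin N) => gaussPdf N0 y * Real.exp (C * (1 + ‖y‖)) := by
  have hint : Integrable fun y : EuclideanSpace ℝ (Fin N) =>
      Real.exp (-(1 / (2 * N0)) * ‖y‖ ^ 2) := by
    have hb : 0 < 1 / (2 * N0) := by positivity
    have h := GaussianFourier.integral_rexp_neg_mul_sq_norm
      (V := EuclideanSpace ℝ (Fin N)) hb
    -- A non-integrable function has integral 0 by convention, whereas the known value is positive.
    by_contra hc
    rw [integral_undef hc] at h
    have := Real.pi_pos
    have : 0 < (Real.pi / (1 / (2 * N0))) ^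
      ((Module.finrank ℝ (EuclideanSpace ℝ (Fin N)) : ℝ) / 2) := by positivity
    linarith
  refine (hint.const_mul (1 / (N0 * Real.pi) ^ ((N : ℝ) / 2) *
    Real.exp (C + N0 * C ^ 2 / 2))).mono' ?_ ?_
  · exact Continuous.aestronglyMeasurable (by unfold gaussPdf; fun_prop)
  · refine Eventually.of_forall fun y => ?_
    have h0 := gaussPdf_pos hN0 y
    rw [Real.norm_of_nonneg (by positivity), gaussPdf, mul_assoc, mul_assoc, ← Real.exp_add,
      ← Real.exp_add]
    have := Real.pi_pos
    refine mul_le_mul_of_nonneg_left (Real.exp_le_exp.2 ?_) (by positivity)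
    have e : C + N0 * C ^ 2 / 2 + -(1 / (2 * N0)) * ‖y‖ ^ 2
        - (-(‖y‖ ^ 2 / N0) + C * (1 + ‖y‖)) = (N0 * C - ‖y‖) ^ 2 / (2 * N0) := by
      field_simp; ring
    have : 0 ≤ (N0 * C - ‖y‖) ^ 2 / (2 * N0) := by positivity
    linarith

lemma integrable_gaussPdf {N0 : ℝ} (hN0 : 0 < N0) :
    Integrable fun y : EuclideanSpace ℝ (Fin N) => gaussPdf N0 y := by
  simpa using integrable_gaussPdf_mul_exp (N := N) hN0 0

lemma integral_gaussPdf_mul_likelihood {N0 : ℝ} (hN0 : 0 < N0) (a : EuclideanSpace ℝ (Fin N)) :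
    ∫ y, gaussPdf N0 y * likelihood N0 a y = 1 := by
  simp_rw [← gaussPdf_sub]
  rw [integral_sub_right_eq_self (gaussPdf N0) a, integral_gaussPdf hN0]

lemma integrable_gaussPdf_mul_likelihood {N0 : ℝ} (hN0 : 0 < N0)
    (a : EuclideanSpace ℝ (Fin N)) :
    Integrable fun y => gaussPdf N0 y * likelihood N0 a y := by
  simp_rw [← gaussPdf_sub]
  exact (integrable_gaussPdf hN0).comp_sub_right a

lemma continuous_likelihood (N0 : ℝ) (a : EuclideanSpace ℝ (Fin N)) :
    Continuous (likelihood N0 a) := by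
  unfold likelihood; fun_prop

lemma continuous_gaussPdf (N0 : ℝ) : Continuous (gaussPdf (N := N) N0) := by
  unfold gaussPdf; fun_prop

lemma integrable_gaussPdf_mul_inner {N0 : ℝ} (hN0 : 0 < N0) (a : EuclideanSpace ℝ (Fin N)) :
    Integrable fun y => gaussPdf N0 y * ⟪a, y⟫ := by
  refine ((integrable_gaussPdf_mul_exp hN0 1).const_mul ‖a‖).mono'
    ((continuous_gaussPdf N0).mul (by fun_prop)).aestronglyMeasurable
    (Eventually.of_forall fun y => ?_)
  have h0 := gaussPdf_pos hN0 y
  rw [norm_mul, Real.norm_of_nonneg h0.le]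
  have h1 : ‖⟪a, y⟫‖ ≤ ‖a‖ * ‖y‖ := norm_inner_le_norm a y
  have h2 : ‖y‖ ≤ Real.exp (1 * (1 + ‖y‖)) := by
    have := Real.add_one_le_exp (1 * (1 + ‖y‖))
    linarith
  calc gaussPdf N0 y * ‖⟪a, y⟫‖ ≤ gaussPdf N0 y * (‖a‖ * Real.exp (1 * (1 + ‖y‖))) := by
        gcongr; exact h1.trans (by gcongr)
    _ = _ := by ring

lemma integral_gaussPdf_mul_inner (N0 : ℝ) (a : EuclideanSpace ℝ (Fin N)) :
    ∫ y, gaussPdf N0 y * ⟪a, y⟫ = 0 := by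
  have h := integral_neg_eq_self (fun y => gaussPdf N0 y * ⟪a, y⟫) volume
  have e : ∀ y : EuclideanSpace ℝ (Fin N),
      gaussPdf N0 (-y) * ⟪a, -y⟫ = -(gaussPdf N0 y * ⟪a, y⟫) := by
    intro y; simp [gaussPdf]
  simp only [e] at h
  rw [integral_neg] at h
  linarith

/-- The logarithm of the likelihood ratio is affine in `y`; recentred at `a`, its integral needs
only the mass and the mean of the noise. -/
lemma gaussPdf_mul_likelihood_mul_log_eq (N0 : ℝ) (a y : EuclideanSpace ℝ (Fin N)) :
    gaussPdf N0 y * (likelihood N0 a y * Real.log (likelihood N0 a y))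
      = gaussPdf N0 (y - a) * ((2 * ⟪a, y - a⟫ + ‖a‖ ^ 2) / N0) := by
  rw [gaussPdf_sub, inner_sub_right, real_inner_self_eq_norm_sq]
  nth_rw 2 [likelihood]
  rw [Real.log_exp]
  ring

lemma integrable_gaussPdf_mul_affine {N0 : ℝ} (hN0 : 0 < N0) (a : EuclideanSpace ℝ (Fin N)) :
    Integrable fun y => gaussPdf N0 y * ((2 * ⟪a, y⟫ + ‖a‖ ^ 2) / N0) := by
  refine (((integrable_gaussPdf_mul_inner hN0 a).const_mul (2 / N0)).add
    ((integrable_gaussPdf hN0).const_mul (‖a‖ ^ 2 / N0))).congr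
    (Eventually.of_forall fun y => ?_)
  simp only [Pi.add_apply]
  ring

lemma integrable_likelihood_mul_log {N0 : ℝ} (hN0 : 0 < N0) (a : EuclideanSpace ℝ (Fin N)) :
    Integrable fun y =>
      gaussPdf N0 y * (likelihood N0 a y * Real.log (likelihood N0 a y)) := by
  simp_rw [gaussPdf_mul_likelihood_mul_log_eq]
  exact (integrable_gaussPdf_mul_affine hN0 a).comp_sub_right a

lemma integral_likelihood_mul_log {N0 : ℝ} (hN0 : 0 < N0) (a : EuclideanSpace ℝ (Fin N)) :
    ∫ y, gaussPdf N0 y * (likelihood N0 a y * Real.log (likelihood N0 a y)) = ‖a‖ ^ 2 / N0 := by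
  simp_rw [gaussPdf_mul_likelihood_mul_log_eq]
  rw [integral_sub_right_eq_self
    (fun y => gaussPdf N0 y * ((2 * ⟪a, y⟫ + ‖a‖ ^ 2) / N0)) a]
  have e : ∀ y : EuclideanSpace ℝ (Fin N), gaussPdf N0 y * ((2 * ⟪a, y⟫ + ‖a‖ ^ 2) / N0)
      = 2 / N0 * (gaussPdf N0 y * ⟪a, y⟫) + ‖a‖ ^ 2 / N0 * gaussPdf N0 y := by
    intro y; ring
  simp_rw [e]
  rw [integral_add ((integrable_gaussPdf_mul_inner hN0 a).const_mul _)
    ((integrable_gaussPdf hN0).const_mul _), integral_const_mul, integral_const_mul,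
    integral_gaussPdf_mul_inner, integral_gaussPdf hN0]
  ring

end Gaussian

-- Relative entropy of Gaussian mixtures with small shifts

section Mixture

variable {N : ℕ} {ι : Type*} [Fintype ι]

/-- The likelihood ratio between the mixture of the noise shifted by the `a i` with weights
`w i`, and the noise. -/
def mixLikelihood (N0 : ℝ) (w : ι → ℝ) (a : ι → EuclideanSpace ℝ (Fin N))
    (y : EuclideanSpace ℝ (Fin N)) : ℝ :=
  ∑ i, w i * likelihood N0 (a i) y

/-- The relative entropy (in nats) of a Gaussian mixture with respect to the noise. -/
def mixEntropy (N0 : ℝ) (w : ι → ℝ) (a : ι → EuclideanSpace ℝ (Fin N)) : ℝ :=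
  ∫ y, gaussPdf N0 y * (mixLikelihood N0 w a y * Real.log (mixLikelihood N0 w a y))

variable {N0 : ℝ} {w : ι → ℝ}

lemma mixLikelihood_pos (hw0 : ∀ i, 0 ≤ w i) (hw1 : ∑ i, w i = 1)
    (a : ι → EuclideanSpace ℝ (Fin N)) (y : EuclideanSpace ℝ (Fin N)) :
    0 < mixLikelihood N0 w a y := by
  have hne : ∃ i ∈ Finset.univ, w i ≠ 0 := by
    by_contra! hc
    rw [Finset.sum_eq_zero hc] at hw1
    exact zero_ne_one hw1
  obtain ⟨i, hi, hwi⟩ := hne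
  exact Finset.sum_pos' (fun j _ => mul_nonneg (hw0 j) (likelihood_pos _ _ _).le)
    ⟨i, hi, mul_pos ((hw0 i).lt_of_ne' hwi) (likelihood_pos _ _ _)⟩

lemma continuous_mixLikelihood (N0 : ℝ) (w : ι → ℝ) (a : ι → EuclideanSpace ℝ (Fin N)) :
    Continuous (mixLikelihood N0 w a) := by
  unfold mixLikelihood
  exact continuous_finsetSum _ fun i _ => (continuous_likelihood N0 (a i)).const_mul _

/-- With exponent `v` and `|v| ≤ |t| s`, use `|e^v - 1| ≤ |v| e^|v|` and `s ≤ e^s`; the two factors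
`e^s` explain the 2. The factor `|t|` is what lets the squared bound survive division by `t²`. -/
lemma abs_likelihood_smul_sub_one_le (hN0 : 0 < N0) {A : ℝ} {a : EuclideanSpace ℝ (Fin N)}
    (ha : ‖a‖ ≤ A) {t : ℝ} (ht : |t| ≤ 1) (y : EuclideanSpace ℝ (Fin N)) :
    |likelihood N0 (t • a) y - 1|
      ≤ |t| * Real.exp (2 * ((2 * A + A ^ 2) / N0) * (1 + ‖y‖)) := by
  set K := (2 * A + A ^ 2) / N0 with hK
  have hA : 0 ≤ A := (norm_nonneg a).trans ha
  have hK0 : 0 ≤ K := by positivity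
  set v := (2 * ⟪t • a, y⟫ - ‖t • a‖ ^ 2) / N0 with hv
  set s := K * (1 + ‖y‖) with hs
  have hs0 : 0 ≤ s := by positivity
  have hvs : |v| ≤ |t| * s := by
    have h1 : |⟪t • a, y⟫| ≤ |t| * (A * ‖y‖) := by
      rw [real_inner_smul_left, abs_mul]
      gcongr
      exact (abs_real_inner_le_norm a y).trans (by gcongr)
    have h2 : ‖t • a‖ ^ 2 ≤ |t| * A ^ 2 := by
      rw [norm_smul, mul_pow, Real.norm_eq_abs]
      have : |t| ^ 2 ≤ |t| := by nlinarith [abs_nonneg t]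
      gcongr
    rw [hv, abs_div, abs_of_pos hN0, div_le_iff₀ hN0]
    have e : |t| * s * N0 = |t| * ((2 * A + A ^ 2) * (1 + ‖y‖)) := by
      rw [hs, hK]; field_simp
    rw [e]
    calc |2 * ⟪t • a, y⟫ - ‖t • a‖ ^ 2| ≤ |2 * ⟪t • a, y⟫| + |‖t • a‖ ^ 2| := abs_sub _ _
      _ = 2 * |⟪t • a, y⟫| + ‖t • a‖ ^ 2 := by
        rw [abs_mul, abs_of_nonneg (sq_nonneg ‖t • a‖)]; norm_num
      _ ≤ 2 * (|t| * (A * ‖y‖)) + |t| * A ^ 2 := by gcongr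
      _ = |t| * (2 * A * ‖y‖ + A ^ 2) := by ring
      _ ≤ |t| * ((2 * A + A ^ 2) * (1 + ‖y‖)) := by
        gcongr
        nlinarith [norm_nonneg y, mul_nonneg (sq_nonneg A) (norm_nonneg y)]
  have hvs' : |v| ≤ s := hvs.trans (mul_le_of_le_one_left hs0 ht)
  have hexp : |Real.exp v - 1| ≤ |v| * Real.exp |v| := by
    have h1 := Real.add_one_le_exp v
    have h2 := Real.add_one_le_exp (-v)
    have h3 := Real.exp_pos v
    have h4 : Real.exp (-v) * Real.exp v = 1 := by rw [← Real.exp_add]; simp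
    have h5 : Real.exp v - 1 ≤ v * Real.exp v := by nlinarith
    have h6 : 1 ≤ Real.exp |v| := Real.one_le_exp (abs_nonneg v)
    have h7 : v * Real.exp v ≤ |v| * Real.exp |v| := by
      calc v * Real.exp v ≤ |v| * Real.exp v := by gcongr; exact le_abs_self v
        _ ≤ |v| * Real.exp |v| := by gcongr; exact le_abs_self v
    rw [abs_le]
    constructor
    · have := neg_abs_le v
      nlinarith [abs_nonneg v]
    · linarith
  have hse : s ≤ Real.exp s := by
    have := Real.add_one_le_exp s
    linarith
  calc |likelihood N0 (t • a) y - 1| = |Real.exp v - 1| := rfl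
    _ ≤ |v| * Real.exp |v| := hexp
    _ ≤ (|t| * s) * Real.exp s := by gcongr
    _ ≤ (|t| * Real.exp s) * Real.exp s := by gcongr
    _ = |t| * Real.exp (2 * K * (1 + ‖y‖)) := by
      rw [mul_assoc, ← Real.exp_add, hs]; congr 2; ring

lemma exists_abs_mixLikelihood_smul_sub_one_le (hN0 : 0 < N0) (hw0 : ∀ i, 0 ≤ w i)
    (hw1 : ∑ i, w i = 1) (a : ι → EuclideanSpace ℝ (Fin N)) :
    ∃ K : ℝ, ∀ t : ℝ, |t| ≤ 1 → ∀ y,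
      |mixLikelihood N0 w (fun i => t • a i) y - 1| ≤ |t| * Real.exp (K * (1 + ‖y‖)) := by
  set A := ∑ i, ‖a i‖
  refine ⟨2 * ((2 * A + A ^ 2) / N0), fun t ht y => ?_⟩
  have e : mixLikelihood N0 w (fun i => t • a i) y - 1
      = ∑ i, w i * (likelihood N0 (t • a i) y - 1) := by
    simp only [mixLikelihood, mul_sub, mul_one, Finset.sum_sub_distrib, hw1]
  rw [e]
  refine (Finset.abs_sum_le_sum_abs _ _).trans ?_
  calc ∑ i, |w i * (likelihood N0 (t • a i) y - 1)|
      ≤ ∑ i, w i * (|t| * Real.exp (2 * ((2 * A + A ^ 2) / N0) * (1 + ‖y‖))) := by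
        refine Finset.sum_le_sum fun i _ => ?_
        rw [abs_mul, abs_of_nonneg (hw0 i)]
        exact mul_le_mul_of_nonneg_left (abs_likelihood_smul_sub_one_le hN0
          (Finset.single_le_sum (f := fun i => ‖a i‖) (fun i _ => norm_nonneg _)
            (Finset.mem_univ i)) ht y) (hw0 i)
    _ = _ := by rw [← Finset.sum_mul, hw1, one_mul]

lemma integrable_gaussPdf_mul_mixLikelihood (hN0 : 0 < N0) (w : ι → ℝ)
    (a : ι → EuclideanSpace ℝ (Fin N)) :
    Integrable fun y => gaussPdf N0 y * mixLikelihood N0 w a y := by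
  simp only [mixLikelihood, Finset.mul_sum]
  refine integrable_finsetSum _ fun i _ => ?_
  refine ((integrable_gaussPdf_mul_likelihood hN0 (a i)).const_mul (w i)).congr
    (Eventually.of_forall fun y => ?_)
  simp only
  ring

lemma integral_gaussPdf_mul_mixLikelihood (hN0 : 0 < N0) (hw1 : ∑ i, w i = 1)
    (a : ι → EuclideanSpace ℝ (Fin N)) :
    ∫ y, gaussPdf N0 y * mixLikelihood N0 w a y = 1 := by
  simp only [mixLikelihood, Finset.mul_sum]
  have e : ∀ i y, gaussPdf N0 y * (w i * likelihood N0 (a i) y)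
      = w i * (gaussPdf N0 y * likelihood N0 (a i) y) := fun i y => by ring
  simp only [e]
  rw [integral_finsetSum _
    fun i _ => (integrable_gaussPdf_mul_likelihood hN0 (a i)).const_mul (w i)]
  simp [integral_const_mul, integral_gaussPdf_mul_likelihood hN0, hw1]

lemma measurable_entropyGap : Measurable entropyGap := by
  unfold entropyGap; fun_prop

/-- When the weights sum to 1, the linear term integrates to zero against the noise, so the entropy
becomes the integral of a nonnegative quantity of second order. -/
lemma mixLikelihood_mul_log_eq (w : ι → ℝ) (a : ι → EuclideanSpace ℝ (Fin N))
    (y : EuclideanSpace ℝ (Fin N)) :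
    mixLikelihood N0 w a y * Real.log (mixLikelihood N0 w a y)
      = entropyGap (mixLikelihood N0 w a y - 1) + (mixLikelihood N0 w a y - 1) := by
  simp [entropyGap]

lemma gaussPdf_mul_entropyGap_le (hN0 : 0 < N0) (hw0 : ∀ i, 0 ≤ w i) (hw1 : ∑ i, w i = 1)
    {a : ι → EuclideanSpace ℝ (Fin N)} {y : EuclideanSpace ℝ (Fin N)} {t K : ℝ}
    (h : |mixLikelihood N0 w a y - 1| ≤ |t| * Real.exp (K * (1 + ‖y‖))) :
    ‖gaussPdf N0 y * entropyGap (mixLikelihood N0 w a y - 1)‖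
      ≤ t ^ 2 * (gaussPdf N0 y * Real.exp (2 * K * (1 + ‖y‖))) := by
  have hg := gaussPdf_pos hN0 y
  have hL : 0 < 1 + (mixLikelihood N0 w a y - 1) := by
    simpa using mixLikelihood_pos (N0 := N0) hw0 hw1 a y
  rw [Real.norm_of_nonneg (mul_nonneg hg.le (entropyGap_nonneg hL))]
  have h2 : entropyGap (mixLikelihood N0 w a y - 1) ≤ t ^ 2 * Real.exp (2 * K * (1 + ‖y‖)) := by
    refine (entropyGap_le_sq hL).trans ?_
    rw [← sq_abs]
    refine (pow_le_pow_left₀ (abs_nonneg _) h 2).trans (le_of_eq ?_)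
    rw [mul_pow, sq_abs, ← Real.exp_nat_mul]
    congr 2
    push_cast; ring
  calc _ ≤ gaussPdf N0 y * (t ^ 2 * Real.exp (2 * K * (1 + ‖y‖))) := by gcongr
    _ = _ := by ring

lemma integrable_entropyGap (hN0 : 0 < N0) (hw0 : ∀ i, 0 ≤ w i) (hw1 : ∑ i, w i = 1)
    (a : ι → EuclideanSpace ℝ (Fin N)) :
    Integrable fun y => gaussPdf N0 y * entropyGap (mixLikelihood N0 w a y - 1) := by
  obtain ⟨K, hK⟩ := exists_abs_mixLikelihood_smul_sub_one_le hN0 hw0 hw1 a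
  refine ((integrable_gaussPdf_mul_exp hN0 (2 * K)).const_mul (1 ^ 2)).mono' ?_
    (Eventually.of_forall fun y => ?_)
  · exact ((continuous_gaussPdf N0).measurable.mul (measurable_entropyGap.comp
      ((continuous_mixLikelihood N0 w a).measurable.sub_const 1))).aestronglyMeasurable
  · have := hK 1 (by simp) y
    simp only [one_smul] at this
    exact gaussPdf_mul_entropyGap_le hN0 hw0 hw1 this

lemma integrable_gaussPdf_mul_mixLikelihood_sub_one (hN0 : 0 < N0) (w : ι → ℝ)
    (a : ι → EuclideanSpace ℝ (Fin N)) :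
    Integrable fun y => gaussPdf N0 y * (mixLikelihood N0 w a y - 1) := by
  simp only [mul_sub, mul_one]
  exact (integrable_gaussPdf_mul_mixLikelihood hN0 w a).sub (integrable_gaussPdf hN0)

lemma integrable_mixLikelihood_mul_log (hN0 : 0 < N0) (hw0 : ∀ i, 0 ≤ w i)
    (hw1 : ∑ i, w i = 1) (a : ι → EuclideanSpace ℝ (Fin N)) :
    Integrable fun y =>
      gaussPdf N0 y * (mixLikelihood N0 w a y * Real.log (mixLikelihood N0 w a y)) := by
  simp only [mixLikelihood_mul_log_eq, mul_add]
  exact (integrable_entropyGap hN0 hw0 hw1 a).add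
    (integrable_gaussPdf_mul_mixLikelihood_sub_one hN0 w a)

lemma mixEntropy_eq_integral_entropyGap (hN0 : 0 < N0) (hw0 : ∀ i, 0 ≤ w i)
    (hw1 : ∑ i, w i = 1) (a : ι → EuclideanSpace ℝ (Fin N)) :
    mixEntropy N0 w a = ∫ y, gaussPdf N0 y * entropyGap (mixLikelihood N0 w a y - 1) := by
  unfold mixEntropy
  simp only [mixLikelihood_mul_log_eq, mul_add]
  rw [integral_add (integrable_entropyGap hN0 hw0 hw1 a)
    (integrable_gaussPdf_mul_mixLikelihood_sub_one hN0 w a)]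
  simp only [mul_sub, mul_one]
  rw [integral_sub (integrable_gaussPdf_mul_mixLikelihood hN0 w a) (integrable_gaussPdf hN0),
    integral_gaussPdf_mul_mixLikelihood hN0 hw1, integral_gaussPdf hN0, sub_self, add_zero]

lemma mixEntropy_nonneg (hN0 : 0 < N0) (hw0 : ∀ i, 0 ≤ w i) (hw1 : ∑ i, w i = 1)
    (a : ι → EuclideanSpace ℝ (Fin N)) : 0 ≤ mixEntropy N0 w a := by
  rw [mixEntropy_eq_integral_entropyGap hN0 hw0 hw1]
  refine integral_nonneg fun y => mul_nonneg (gaussPdf_pos hN0 y).le (entropyGap_nonneg ?_)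
  simpa using mixLikelihood_pos hw0 hw1 a y

/-- Convexity of `x log x`. The bound is quadratic in the shifts at every amplitude, so it is
integrable over the fading with second moments only. -/
lemma mixEntropy_le (hN0 : 0 < N0) (hw0 : ∀ i, 0 ≤ w i) (hw1 : ∑ i, w i = 1)
    (a : ι → EuclideanSpace ℝ (Fin N)) :
    mixEntropy N0 w a ≤ ∑ i, w i * (‖a i‖ ^ 2 / N0) := by
  have hint : ∀ i ∈ Finset.univ, Integrable fun y =>
      w i * (gaussPdf N0 y * (likelihood N0 (a i) y * Real.log (likelihood N0 (a i) y))) :=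
    fun i _ => (integrable_likelihood_mul_log hN0 (a i)).const_mul (w i)
  have e : ∑ i, w i * (‖a i‖ ^ 2 / N0) = ∫ y, ∑ i,
      w i * (gaussPdf N0 y * (likelihood N0 (a i) y * Real.log (likelihood N0 (a i) y))) := by
    rw [integral_finsetSum _ hint]
    simp only [integral_const_mul, integral_likelihood_mul_log hN0]
  rw [e]
  refine integral_mono (integrable_mixLikelihood_mul_log hN0 hw0 hw1 a)
    (integrable_finsetSum _ hint) fun y => ?_
  have hconv := Real.convexOn_mul_log.map_sum_le (t := Finset.univ) (w := w)
    (p := fun i => likelihood N0 (a i) y) (fun i _ => hw0 i) hw1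
    (fun i _ => (likelihood_pos N0 (a i) y).le)
  simp only [smul_eq_mul] at hconv
  calc gaussPdf N0 y * (mixLikelihood N0 w a y * Real.log (mixLikelihood N0 w a y))
      ≤ gaussPdf N0 y * ∑ i, w i * (likelihood N0 (a i) y * Real.log (likelihood N0 (a i) y)) :=
        mul_le_mul_of_nonneg_left hconv (gaussPdf_pos hN0 y).le
    _ = _ := by
      rw [Finset.mul_sum]
      exact Finset.sum_congr rfl fun i _ => by ring

lemma hasDerivAt_mixLikelihood_smul (N0 : ℝ) (w : ι → ℝ)
    (a : ι → EuclideanSpace ℝ (Fin N)) (y : EuclideanSpace ℝ (Fin N)) :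
    HasDerivAt (fun t : ℝ => mixLikelihood N0 w (fun i => t • a i) y)
      (2 * ⟪∑ i, w i • a i, y⟫ / N0) 0 := by
  have e : 2 * ⟪∑ i, w i • a i, y⟫ / N0 = ∑ i, w i * (2 * ⟪a i, y⟫ / N0) := by
    rw [sum_inner, Finset.mul_sum, Finset.sum_div]
    exact Finset.sum_congr rfl fun i _ => by rw [real_inner_smul_left]; ring
  rw [e]
  refine HasDerivAt.fun_sum fun i _ => HasDerivAt.const_mul _ ?_
  have e2 : ∀ t : ℝ, likelihood N0 (t • a i) y
      = Real.exp (t * (2 * ⟪a i, y⟫ / N0) - t ^ 2 * (‖a i‖ ^ 2 / N0)) := by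
    intro t
    rw [likelihood, real_inner_smul_left, norm_smul, mul_pow, Real.norm_eq_abs, sq_abs]
    congr 1
    ring
  simp only [e2]
  have h1 : HasDerivAt (fun t : ℝ => t * (2 * ⟪a i, y⟫ / N0) - t ^ 2 * (‖a i‖ ^ 2 / N0))
      (1 * (2 * ⟪a i, y⟫ / N0) - (2 * (0 : ℝ) ^ 1 * 1) * (‖a i‖ ^ 2 / N0)) 0 := by
    refine ((hasDerivAt_id (0 : ℝ)).mul_const _).sub (HasDerivAt.mul_const ?_ _)
    simpa using (hasDerivAt_pow 2 (0 : ℝ))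
  exact h1.exp.congr_deriv (by simp)

/-- Dominated convergence: pointwise in `y` the gap is half the squared derivative at `t = 0`, which
sees only the mean of the shifts. -/
lemma tendsto_mixEntropy_integral (hN0 : 0 < N0) (hw0 : ∀ i, 0 ≤ w i) (hw1 : ∑ i, w i = 1)
    (a : ι → EuclideanSpace ℝ (Fin N)) :
    Tendsto (fun t : ℝ => mixEntropy N0 w (fun i => t • a i) / t ^ 2) (𝓝[≠] 0)
      (𝓝 (∫ y, gaussPdf N0 y * ((2 * ⟪∑ i, w i • a i, y⟫ / N0) ^ 2 / 2))) := by
  obtain ⟨K, hK⟩ := exists_abs_mixLikelihood_smul_sub_one_le hN0 hw0 hw1 a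
  have e : ∀ t : ℝ, mixEntropy N0 w (fun i => t • a i) / t ^ 2
      = ∫ y, gaussPdf N0 y *
        (entropyGap (mixLikelihood N0 w (fun i => t • a i) y - 1) / t ^ 2) := by
    intro t
    rw [mixEntropy_eq_integral_entropyGap hN0 hw0 hw1, ← integral_div]
    simp only [mul_div_assoc]
  simp only [e]
  refine tendsto_integral_filter_of_dominated_convergence
    (fun y => gaussPdf N0 y * Real.exp (2 * K * (1 + ‖y‖))) ?_ ?_
    (integrable_gaussPdf_mul_exp hN0 (2 * K)) ?_
  · refine Eventually.of_forall fun t => Measurable.aestronglyMeasurable ?_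
    exact (continuous_gaussPdf N0).measurable.mul ((measurable_entropyGap.comp
      ((continuous_mixLikelihood N0 w _).measurable.sub_const 1)).div_const _)
  · have hsmall : ∀ᶠ t in 𝓝[≠] (0 : ℝ), |t| < 1 := by
      have h : Tendsto (fun t : ℝ => |t|) (𝓝[≠] 0) (𝓝 0) := by
        have := (continuous_abs (G := ℝ)).tendsto 0
        rw [abs_zero] at this
        exact this.mono_left nhdsWithin_le_nhds
      exact h.eventually_lt_const one_pos
    filter_upwards [hsmall, self_mem_nhdsWithin] with t ht ht0
    refine Eventually.of_forall fun y => ?_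
    have ht0' : t ≠ 0 := ht0
    have h2 : 0 < t ^ 2 := by positivity
    have := gaussPdf_mul_entropyGap_le hN0 hw0 hw1 (hK t ht.le y)
    rw [← mul_div_assoc, norm_div, Real.norm_of_nonneg h2.le, div_le_iff₀ h2, mul_comm _ (t ^ 2)]
    exact this
  · refine Eventually.of_forall fun y => Tendsto.const_mul _ ?_
    refine tendsto_entropyGap_div_sq
      (f := fun t => mixLikelihood N0 w (fun i => t • a i) y - 1) ?_
      ((hasDerivAt_mixLikelihood_smul N0 w a y).sub_const 1)
    simp [mixLikelihood, likelihood, hw1]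

/-- The second moment of the Gaussian noise in direction `a`. -/
lemma integral_gaussPdf_mul_inner_sq (hN0 : 0 < N0) (a : EuclideanSpace ℝ (Fin N)) :
    ∫ y, gaussPdf N0 y * ((2 * ⟪a, y⟫ / N0) ^ 2 / 2) = ‖a‖ ^ 2 / N0 := by
  -- For a single shift the entropy is exactly `t² ‖a‖² / N0`, so uniqueness of the limit evaluates
  -- the Gaussian second moment without a direct computation.
  have h := tendsto_mixEntropy_integral (ι := Unit) (w := fun _ => 1) hN0 (fun _ => zero_le_one)
    (by simp) (fun _ => a)
  simp only [Finset.univ_unique, Finset.sum_singleton, one_smul] at h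
  refine tendsto_nhds_unique h (Tendsto.congr' ?_ tendsto_const_nhds)
  filter_upwards [self_mem_nhdsWithin] with t ht
  have ht0 : t ≠ 0 := ht
  simp only [mixEntropy, mixLikelihood, Finset.univ_unique, Finset.sum_singleton, one_mul]
  rw [integral_likelihood_mul_log hN0, norm_smul, mul_pow, Real.norm_eq_abs, sq_abs]
  field_simp

/-- The relative entropy of a Gaussian mixture of small amplitude is asymptotically that of the
single Gaussian with the same mean. -/
lemma tendsto_mixEntropy_smul_div_sq (hN0 : 0 < N0) (hw0 : ∀ i, 0 ≤ w i) (hw1 : ∑ i, w i = 1)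
    (a : ι → EuclideanSpace ℝ (Fin N)) :
    Tendsto (fun t : ℝ => mixEntropy N0 w (fun i => t • a i) / t ^ 2) (𝓝[≠] 0)
      (𝓝 (‖∑ i, w i • a i‖ ^ 2 / N0)) := by
  rw [← integral_gaussPdf_mul_inner_sq hN0]
  exact tendsto_mixEntropy_integral hN0 hw0 hw1 a

end Mixture

-- Independent bits and the orthogonal decomposition of functions of the symbol

section Bits

variable {m : ℕ}

lemma nbc_injective : Function.Injective (nbc : Fin (2 ^ m) → Fin m → Bool) := by
  intro i j h
  refine Fin.ext (Nat.eq_of_testBit_eq fun k => ?_)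
  by_cases hk : k < m
  · exact congrFun h ⟨k, hk⟩
  · have hle : 2 ^ m ≤ 2 ^ k := Nat.pow_le_pow_right (by norm_num) (not_lt.1 hk)
    rw [Nat.testBit_eq_false_of_lt (i.2.trans_le hle),
      Nat.testBit_eq_false_of_lt (j.2.trans_le hle)]

lemma nbc_bijective : Function.Bijective (nbc : Fin (2 ^ m) → Fin m → Bool) :=
  (Fintype.bijective_iff_injective_and_card _).2 ⟨nbc_injective, by simp⟩

/-- Symbols correspond bijectively to bit strings, so this is the expansion of a product of sums. It
is the source of the independence identities below and of Hadamard orthogonality. -/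
lemma sum_prod_nbc (F : Fin m → Bool → ℝ) :
    ∑ i : Fin (2 ^ m), ∏ k, F k (nbc i k) = ∏ k, ∑ u, F k u := by
  rw [Finset.prod_univ_sum, Fintype.piFinset_univ]
  exact nbc_bijective.sum_comp fun v : Fin m → Bool => ∏ k, F k (v k)

lemma sum_bitProb (b : Fin m → ℝ) (k : Fin m) : ∑ u, bitProb b k u = 1 := by
  simp [bitProb]

lemma bitProb_pos {b : Fin m → ℝ} (hb : ∀ k, 0 < b k ∧ b k < 1) (k : Fin m) (u : Bool) :
    0 < bitProb b k u := by
  have := hb k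
  cases u <;> simp [bitProb, this.1, this.2]

lemma symProb_pos {b : Fin m → ℝ} (hb : ∀ k, 0 < b k ∧ b k < 1) (i : Fin (2 ^ m)) :
    0 < symProb b i :=
  Finset.prod_pos fun k _ => bitProb_pos hb k _

/-- The expectation of a real function of the transmitted symbol. -/
def expect (b : Fin m → ℝ) : (Fin (2 ^ m) → ℝ) →ₗ[ℝ] ℝ :=
  ∑ i, symProb b i • LinearMap.proj i

lemma expect_apply (b : Fin m → ℝ) (x : Fin (2 ^ m) → ℝ) :
    expect b x = ∑ i, symProb b i * x i := by
  simp [expect]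

lemma expect_prod (b : Fin m → ℝ) (F : Fin m → Bool → ℝ) :
    expect b (fun i => ∏ k, F k (nbc i k)) = ∏ k, ∑ u, bitProb b k u * F k u := by
  rw [← sum_prod_nbc, expect_apply]
  simp only [symProb, Finset.prod_mul_distrib]

lemma expect_bit (b : Fin m → ℝ) (k : Fin m) (f : Bool → ℝ) :
    expect b (fun i => f (nbc i k)) = ∑ u, bitProb b k u * f u := by
  have h := expect_prod b fun l u => if l = k then f u else 1
  simp only [Finset.prod_ite_eq', Finset.mem_univ, if_true] at h
  rw [h, Finset.prod_eq_single k]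
  · simp
  · intro l _ hl
    simp only [hl, if_false, mul_one]
    exact sum_bitProb b l
  · simp

lemma expect_bit_mul_bit (b : Fin m → ℝ) {k l : Fin m} (hkl : k ≠ l) (f g : Bool → ℝ) :
    expect b (fun i => f (nbc i k) * g (nbc i l))
      = (∑ u, bitProb b k u * f u) * ∑ u, bitProb b l u * g u := by
  have h := expect_prod b fun j u => (if j = k then f u else 1) * (if j = l then g u else 1)
  simp only [Finset.prod_mul_distrib, Finset.prod_ite_eq', Finset.mem_univ, if_true] at h
  rw [h, Finset.prod_eq_mul k l hkl]
  · simp [hkl, hkl.symm]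
  · intro j _ hj
    simp only [hj.1, hj.2, if_false, mul_one]
    exact sum_bitProb b j
  · simp
  · simp

lemma expect_const (b : Fin m → ℝ) (c : ℝ) : expect b (fun _ => c) = c := by
  have h := expect_prod b fun _ _ => 1
  simp only [Finset.prod_const_one, mul_one, sum_bitProb] at h
  have e : (fun _ : Fin (2 ^ m) => c) = c • fun _ => 1 := by ext; simp
  rw [e, map_smul, h, smul_eq_mul, mul_one]

lemma sum_symProb (b : Fin m → ℝ) : ∑ i, symProb b i = 1 := by
  simpa [expect_apply] using expect_const b 1

/-- The probability of the symbol `i` given `C_k = u`. -/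
def condProb (b : Fin m → ℝ) (k : Fin m) (u : Bool) (i : Fin (2 ^ m)) : ℝ :=
  if nbc i k = u then symProb b i / bitProb b k u else 0

/-- The conditional expectation given `C_k = u` of a function of the transmitted symbol. -/
def condExpect (b : Fin m → ℝ) (k : Fin m) (u : Bool) : (Fin (2 ^ m) → ℝ) →ₗ[ℝ] ℝ :=
  ∑ i, condProb b k u i • LinearMap.proj i

lemma condExpect_apply (b : Fin m → ℝ) (k : Fin m) (u : Bool) (x : Fin (2 ^ m) → ℝ) :
    condExpect b k u x = ∑ i, condProb b k u i * x i := by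
  simp [condExpect]

variable {b : Fin m → ℝ}

lemma condProb_nonneg (hb : ∀ k, 0 < b k ∧ b k < 1) (k : Fin m) (u : Bool) (i : Fin (2 ^ m)) :
    0 ≤ condProb b k u i := by
  unfold condProb
  split_ifs
  · exact (div_pos (symProb_pos hb i) (bitProb_pos hb k u)).le
  · exact le_rfl

lemma condExpect_eq_div (b : Fin m → ℝ) (k : Fin m) (u : Bool) (x : Fin (2 ^ m) → ℝ) :
    condExpect b k u x
      = expect b (fun i => (if nbc i k = u then 1 else 0) * x i) / bitProb b k u := by
  rw [condExpect_apply, expect_apply, Finset.sum_div]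
  refine Finset.sum_congr rfl fun i _ => ?_
  unfold condProb
  split_ifs <;> ring

lemma sum_condProb (hb : ∀ k, 0 < b k ∧ b k < 1) (k : Fin m) (u : Bool) :
    ∑ i, condProb b k u i = 1 := by
  have h := condExpect_eq_div b k u fun _ => 1
  rw [condExpect_apply] at h
  simp only [mul_one] at h
  rw [h, expect_bit b k fun v => if v = u then 1 else 0]
  simp [(bitProb_pos hb k u).ne']

lemma sum_bitProb_mul_condProb (hb : ∀ k, 0 < b k ∧ b k < 1) (k : Fin m) (i : Fin (2 ^ m)) :
    ∑ u, bitProb b k u * condProb b k u i = symProb b i := by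
  simp only [condProb, mul_ite, mul_zero, Finset.sum_ite_eq, Finset.mem_univ, if_true]
  exact mul_div_cancel₀ _ (bitProb_pos hb k _).ne'

lemma condExpect_const (hb : ∀ k, 0 < b k ∧ b k < 1) (k : Fin m) (u : Bool) (c : ℝ) :
    condExpect b k u (fun _ => c) = c := by
  rw [condExpect_apply, ← Finset.sum_mul, sum_condProb hb, one_mul]

lemma condExpect_bit_self (hb : ∀ k, 0 < b k ∧ b k < 1) (k : Fin m) (u : Bool) (f : Bool → ℝ) :
    condExpect b k u (fun i => f (nbc i k)) = f u := by
  rw [condExpect_eq_div, expect_bit b k fun v => (if v = u then 1 else 0) * f v]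
  simp only [ite_mul, one_mul, zero_mul, mul_ite, mul_zero, Finset.sum_ite_eq', Finset.mem_univ,
    if_true]
  exact mul_div_cancel_left₀ _ (bitProb_pos hb k u).ne'

lemma condExpect_bit_of_ne (hb : ∀ k, 0 < b k ∧ b k < 1) {k l : Fin m} (hkl : k ≠ l) (u : Bool)
    (f : Bool → ℝ) :
    condExpect b k u (fun i => f (nbc i l)) = expect b fun i => f (nbc i l) := by
  rw [condExpect_eq_div, expect_bit_mul_bit b hkl (fun v => if v = u then 1 else 0) f,
    expect_bit]
  simp only [mul_ite, mul_one, mul_zero, Finset.sum_ite_eq', Finset.mem_univ, if_true]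
  exact mul_div_cancel_left₀ _ (bitProb_pos hb k u).ne'

/-- The defining property of conditional expectation, tested against functions of `C_k`. -/
lemma sum_bitProb_mul_condExpect (hb : ∀ k, 0 < b k ∧ b k < 1) (k : Fin m)
    (x : Fin (2 ^ m) → ℝ) (g : Bool → ℝ) :
    ∑ u, bitProb b k u * (condExpect b k u x * g u) = expect b fun i => x i * g (nbc i k) := by
  simp only [condExpect_eq_div]
  have e : ∀ u, bitProb b k u *
      (expect b (fun i => (if nbc i k = u then 1 else 0) * x i) / bitProb b k u * g u)
      = expect b fun i => (if nbc i k = u then x i * g u else 0) := by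
    intro u
    have e1 : (fun i => (if nbc i k = u then x i * g u else 0))
        = g u • fun i => (if nbc i k = u then 1 else 0) * x i := by
      ext i
      simp only [Pi.smul_apply, smul_eq_mul]
      split_ifs <;> ring
    rw [e1, map_smul, smul_eq_mul]
    have := (bitProb_pos hb k u).ne'
    field_simp
  simp only [e]
  rw [← map_sum]
  congr 1
  ext i
  simp [Finset.sum_apply]

/-- The variance of the conditional expectation given `C_k`. -/
def condVar (b : Fin m → ℝ) (x : Fin (2 ^ m) → ℝ) (k : Fin m) : ℝ :=
  ∑ u, bitProb b k u * condExpect b k u x ^ 2 - expect b x ^ 2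

/-- The best approximation of a function of the symbol by a constant plus functions of one bit. -/
def bitwiseApprox (b : Fin m → ℝ) (x : Fin (2 ^ m) → ℝ) (i : Fin (2 ^ m)) : ℝ :=
  expect b x + ∑ k, (condExpect b k (nbc i k) x - expect b x)

lemma sum_bitProb_mul_condExpect_sub (hb : ∀ k, 0 < b k ∧ b k < 1) (x : Fin (2 ^ m) → ℝ)
    (k : Fin m) : ∑ u, bitProb b k u * (condExpect b k u x - expect b x) = 0 := by
  have h := sum_bitProb_mul_condExpect hb k x fun _ => 1
  simp only [mul_one] at h
  simp only [mul_sub, Finset.sum_sub_distrib, h, ← Finset.sum_mul, sum_bitProb, one_mul, sub_self]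

lemma expect_mul_condExpect_sub (hb : ∀ k, 0 < b k ∧ b k < 1) (x : Fin (2 ^ m) → ℝ)
    (k : Fin m) :
    expect b (fun i => x i * (condExpect b k (nbc i k) x - expect b x)) = condVar b x k := by
  rw [← sum_bitProb_mul_condExpect hb k x fun u => condExpect b k u x - expect b x]
  have h := sum_bitProb_mul_condExpect_sub hb x k
  have h1 := sum_bitProb b k
  rw [condVar]
  simp only [Fintype.sum_bool] at *
  linear_combination (-expect b x) * h - expect b x ^ 2 * h1

lemma expect_condExpect_sub_mul (hb : ∀ k, 0 < b k ∧ b k < 1) (x : Fin (2 ^ m) → ℝ)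
    (k l : Fin m) :
    expect b (fun i => (condExpect b k (nbc i k) x - expect b x) *
      (condExpect b l (nbc i l) x - expect b x)) = if k = l then condVar b x k else 0 := by
  split_ifs with hkl
  · subst hkl
    rw [expect_bit b k fun u => (condExpect b k u x - expect b x) *
      (condExpect b k u x - expect b x)]
    have h := sum_bitProb_mul_condExpect_sub hb x k
    have h1 := sum_bitProb b k
    rw [condVar]
    simp only [Fintype.sum_bool] at *
    linear_combination (-2 * expect b x) * h - expect b x ^ 2 * h1
  · rw [expect_bit_mul_bit b hkl (fun u => condExpect b k u x - expect b x)
      fun u => condExpect b l u x - expect b x, sum_bitProb_mul_condExpect_sub hb, zero_mul]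

/-- Pythagoras: the energy splits into the mean, the energy explained by the single bits, and
the energy of the residual. -/
lemma expect_sq_eq (hb : ∀ k, 0 < b k ∧ b k < 1) (x : Fin (2 ^ m) → ℝ) :
    expect b (fun i => x i ^ 2) = expect b x ^ 2 + ∑ k, condVar b x k
      + expect b fun i => (x i - bitwiseApprox b x i) ^ 2 := by
  set μ := expect b x with hμ
  set f : Fin m → Fin (2 ^ m) → ℝ := fun k i => condExpect b k (nbc i k) x - μ with hf
  -- The expanded square, arranged as a linear combination so that linearity of `expect` applies;
  -- the bit terms then contribute `-2 + 1` times the sum of the `condVar`.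
  have e : (fun i => (x i - bitwiseApprox b x i) ^ 2)
      = (fun i => x i ^ 2) - (2 * μ) • x + (fun _ => μ ^ 2)
        - (2 : ℝ) • (∑ k, fun i => x i * f k i) + (2 * μ) • (∑ k, f k)
        + ∑ k, ∑ l, fun i => f k i * f l i := by
    ext i
    have h2 : (∑ k, f k i) ^ 2 = ∑ k, ∑ l, f k i * f l i := by
      rw [sq, Finset.sum_mul_sum]
    have h3 : ∑ k, x i * f k i = x i * ∑ k, f k i := by rw [Finset.mul_sum]
    simp only [Pi.add_apply, Pi.sub_apply, Pi.smul_apply, Finset.sum_apply, smul_eq_mul]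
    rw [h3, ← h2]
    have h4 : bitwiseApprox b x i = μ + ∑ k, f k i := rfl
    rw [h4]
    ring
  have hx : ∀ k, expect b (fun i => x i * f k i) = condVar b x k :=
    expect_mul_condExpect_sub hb x
  have hff : ∀ k l, expect b (fun i => f k i * f l i) = if k = l then condVar b x k else 0 :=
    expect_condExpect_sub_mul hb x
  have hf0 : ∀ k, expect b (f k) = 0 := fun k => by
    rw [← sum_bitProb_mul_condExpect_sub hb x k]
    exact expect_bit b k fun u => condExpect b k u x - μ
  rw [e]
  simp only [map_add, map_sub, map_smul, map_sum, hx, hff, hf0, expect_const, smul_eq_mul,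
    Finset.sum_ite_eq, Finset.mem_univ, if_true, Finset.sum_const_zero, ← hμ]
  ring

lemma expect_sq_eq_zero_iff (hb : ∀ k, 0 < b k ∧ b k < 1) (r : Fin (2 ^ m) → ℝ) :
    expect b (fun i => r i ^ 2) = 0 ↔ ∀ i, r i = 0 := by
  rw [expect_apply, Finset.sum_eq_zero_iff_of_nonneg
    fun i _ => mul_nonneg (symProb_pos hb i).le (sq_nonneg _)]
  simp [(symProb_pos hb _).ne']

/-- The sign `(-1)^u` attached to a bit `u`. -/
def sign (u : Bool) : ℝ := (-1) ^ u.toNat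

/-- Conditioning on `C_k` fixes the term of bit `k` and replaces every other term by its mean, so
the projection leaves affine functions of the signs unchanged. -/
lemma bitwiseApprox_eq_of_affine (hb : ∀ k, 0 < b k ∧ b k < 1) (c : ℝ) (ℓ : Fin m → ℝ)
    {x : Fin (2 ^ m) → ℝ} (hx : ∀ i, x i = c + ∑ k, sign (nbc i k) * ℓ k) (i : Fin (2 ^ m)) :
    x i = bitwiseApprox b x i := by
  set g : Fin m → Fin (2 ^ m) → ℝ := fun k i => sign (nbc i k) * ℓ k with hg
  have e : x = (fun _ => c) + ∑ k, g k := by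
    ext i
    simp [hx, hg]
  have hμ : expect b x = c + ∑ k, expect b (g k) := by
    rw [e, map_add, map_sum, expect_const]
  have hc : ∀ k, condExpect b k (nbc i k) x - expect b x = g k i - expect b (g k) := by
    intro k
    have h1 : condExpect b k (nbc i k) x = c + ∑ l, condExpect b k (nbc i k) (g l) := by
      rw [e, map_add, map_sum, condExpect_const hb]
    rw [h1, hμ, add_sub_add_left_eq_sub, ← Finset.sum_sub_distrib, Finset.sum_eq_single k]
    · rw [condExpect_bit_self hb k (nbc i k) fun u => sign u * ℓ k]
    · intro l _ hl
      rw [condExpect_bit_of_ne hb hl.symm (nbc i k) fun u => sign u * ℓ l, sub_self]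
    · simp
  rw [bitwiseApprox]
  simp only [hc]
  rw [Finset.sum_sub_distrib, hμ, hx]
  ring

/-- A function of one bit takes two values: it is their half-sum plus the sign times their
half-difference. -/
lemma exists_affine_bitwiseApprox (b : Fin m → ℝ) (x : Fin (2 ^ m) → ℝ) :
    ∃ (c : ℝ) (ℓ : Fin m → ℝ), ∀ i, bitwiseApprox b x i = c + ∑ k, sign (nbc i k) * ℓ k := by
  refine ⟨expect b x + ∑ k, ((condExpect b k false x + condExpect b k true x) / 2 - expect b x),
    fun k => (condExpect b k false x - condExpect b k true x) / 2, fun i => ?_⟩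
  rw [bitwiseApprox, add_assoc, ← Finset.sum_add_distrib]
  congr 1
  refine Finset.sum_congr rfl fun k _ => ?_
  cases nbc i k <;> simp [sign] <;> ring

end Bits

-- Affine images of the hypercube

section Alphabets

variable {m N : ℕ}

/-- The alphabet is an affine image of the hypercube. -/
def IsAffineCube (X : Alphabet m N) : Prop :=
  ∃ (c : EuclideanSpace ℝ (Fin N)) (ℓ : Fin m → EuclideanSpace ℝ (Fin N)),
    ∀ i, X i = c + ∑ k, sign (nbc i k) • ℓ k

lemma mean_apply (b : Fin m → ℝ) (X : Alphabet m N) (n : Fin N) :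
    mean b X n = expect b fun i => X i n := by
  simp [mean, expect_apply]

lemma mean_sub_const (b : Fin m → ℝ) (X : Alphabet m N) (c : EuclideanSpace ℝ (Fin N)) :
    mean b (fun i => X i - c) = mean b X - c := by
  simp only [mean, smul_sub, Finset.sum_sub_distrib, ← Finset.sum_smul, sum_symProb, one_smul]

lemma energy_eq (b : Fin m → ℝ) (X : Alphabet m N) :
    energy b X = ∑ n, expect b fun i => X i n ^ 2 := by
  simp only [energy, expect_apply, EuclideanSpace.real_norm_sq_eq, Finset.mul_sum]
  exact Finset.sum_comm

/-- The energy of the alphabet explained by the single bits. -/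
def bitEnergy (b : Fin m → ℝ) (X : Alphabet m N) : ℝ :=
  ∑ n, ∑ k, condVar b (fun i => X i n) k

lemma bitEnergy_eq_energy_iff {b : Fin m → ℝ} (hb : ∀ k, 0 < b k ∧ b k < 1)
    (X : Alphabet m N) :
    bitEnergy b X = energy b X ↔ mean b X = 0 ∧ IsAffineCube X := by
  have hE : energy b X = ∑ n, (mean b X n ^ 2
      + expect b fun i => (X i n - bitwiseApprox b (fun i => X i n) i) ^ 2) + bitEnergy b X := by
    rw [energy_eq, bitEnergy, ← Finset.sum_add_distrib]
    refine Finset.sum_congr rfl fun n _ => ?_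
    rw [expect_sq_eq hb, mean_apply]
    ring
  have hnn : ∀ n, 0 ≤ expect b fun i => (X i n - bitwiseApprox b (fun i => X i n) i) ^ 2 := by
    intro n
    rw [expect_apply]
    exact Finset.sum_nonneg fun i _ => mul_nonneg (symProb_pos hb i).le (sq_nonneg _)
  have h1 : bitEnergy b X = energy b X ↔
      ∀ n, mean b X n = 0 ∧ ∀ i, X i n = bitwiseApprox b (fun i => X i n) i := by
    rw [hE, right_eq_add, Finset.sum_eq_zero_iff_of_nonneg
      fun n _ => add_nonneg (sq_nonneg _) (hnn n)]
    refine forall_congr' fun n => ?_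
    simp only [Finset.mem_univ, true_imp_iff]
    rw [add_eq_zero_iff_of_nonneg (sq_nonneg _) (hnn n), sq_eq_zero_iff,
      expect_sq_eq_zero_iff hb]
    simp only [sub_eq_zero]
  rw [h1, forall_and]
  refine and_congr ?_ ?_
  · exact ⟨fun h => by ext n; simpa using h n, fun h n => by simp [h]⟩
  · constructor
    · intro h
      choose c ℓ hcℓ using fun n => exists_affine_bitwiseApprox b fun i => X i n
      refine ⟨WithLp.toLp 2 c, fun k => WithLp.toLp 2 fun n => ℓ n k, fun i => ?_⟩
      ext n
      rw [h n i, hcℓ n i]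
      simp
    · rintro ⟨c, ℓ, h⟩ n i
      refine bitwiseApprox_eq_of_affine (x := fun i => X i n) hb (c n) (fun k => ℓ k n)
        (fun i => ?_) i
      simp [h]

lemma isAffineCube_sub_const {X : Alphabet m N} (hX : IsAffineCube X)
    (v : EuclideanSpace ℝ (Fin N)) : IsAffineCube fun i => X i - v := by
  obtain ⟨c, ℓ, h⟩ := hX
  exact ⟨c - v, ℓ, fun i => by simp only [h]; abel⟩

lemma vertex_eq_sum (i : Fin (2 ^ m)) :
    (vertex i : EuclideanSpace ℝ (Fin m))
      = ∑ k, sign (nbc i k) • EuclideanSpace.single k (1 : ℝ) := by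
  ext l
  simp [vertex, sign, Pi.single_apply]

lemma exists_linearMap_iff (b : Fin m → ℝ) (X : Alphabet m N) :
    (∃ L : EuclideanSpace ℝ (Fin m) →ₗ[ℝ] EuclideanSpace ℝ (Fin N),
        ∀ i, X i = L (vertex i) - mean b (fun j => L (vertex j))) ↔
      mean b X = 0 ∧ IsAffineCube X := by
  constructor
  · rintro ⟨L, hL⟩
    obtain rfl : X = fun i => L (vertex i) - mean b (fun j => L (vertex j)) := funext hL
    refine ⟨by rw [mean_sub_const, sub_self], isAffineCube_sub_const ?_ _⟩
    refine ⟨0, fun k => L (EuclideanSpace.single k 1), fun i => ?_⟩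
    simp only [vertex_eq_sum, map_sum, zero_add, map_smul]
  · rintro ⟨hm, c, ℓ, h⟩
    -- The linear part of the affine map. It sends `vertex i` to `X i - c`, and subtracting the mean
    -- cancels `c` because `X` has mean zero.
    refine ⟨∑ k, (EuclideanSpace.proj k : EuclideanSpace ℝ (Fin m) →L[ℝ] ℝ).toLinearMap.smulRight
      (ℓ k), fun i => ?_⟩
    have e : ∀ i, (∑ k, (EuclideanSpace.proj k :
        EuclideanSpace ℝ (Fin m) →L[ℝ] ℝ).toLinearMap.smulRight (ℓ k)) (vertex i)
          = X i - c := by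
      intro i
      rw [h]
      simp [vertex, sign]
    simp only [e]
    rw [mean_sub_const, hm]
    abel

end Alphabets

-- Hadamard transform: orthogonality, inversion and affine alphabets

section Hadamard

variable {m N : ℕ}

/-- The index `2 ^ k`. -/
def powIndex (k : Fin m) : Fin (2 ^ m) := ⟨2 ^ k.val, Nat.pow_lt_pow_right (by norm_num) k.2⟩

lemma hadamardCoeff_powIndex (i : Fin (2 ^ m)) (k : Fin m) :
    hadamardCoeff i (powIndex k) = sign (nbc i k) := by
  rw [hadamardCoeff, Finset.prod_eq_single k]
  · simp [nbc, powIndex, sign]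
  · intro l _ hl
    have : nbc (powIndex k) l = false :=
      Nat.testBit_two_pow_of_ne fun h => hl (Fin.ext h.symm)
    simp [this]
  · simp

lemma hadamardCoeff_zero (i : Fin (2 ^ m)) : hadamardCoeff i 0 = 1 := by
  simp [hadamardCoeff, nbc]

/-- The sum factors over bits; a bit where `i` and `l` differ contributes `1 + (-1) = 0`, any other
contributes 2. -/
lemma sum_hadamardCoeff_mul (i l : Fin (2 ^ m)) :
    ∑ j, hadamardCoeff i j * hadamardCoeff j l = if i = l then 2 ^ m else 0 := by
  have e : ∀ j : Fin (2 ^ m), hadamardCoeff i j * hadamardCoeff j l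
      = ∏ k, (-1 : ℝ) ^ ((nbc i k).toNat * (nbc j k).toNat)
        * (-1) ^ ((nbc j k).toNat * (nbc l k).toNat) := fun j => by
    rw [hadamardCoeff, hadamardCoeff, Finset.prod_mul_distrib]
  simp only [e]
  rw [sum_prod_nbc fun k u => (-1 : ℝ) ^ ((nbc i k).toNat * u.toNat)
        * (-1) ^ (u.toNat * (nbc l k).toNat)]
  split_ifs with h
  · subst h
    have : ∀ k : Fin m, ∑ u : Bool, (-1 : ℝ) ^ ((nbc i k).toNat * u.toNat)
        * (-1) ^ (u.toNat * (nbc i k).toNat) = 2 := fun k => by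
      cases nbc i k <;> norm_num
    rw [Finset.prod_congr rfl fun k _ => this k]
    simp
  · obtain ⟨k, hk⟩ : ∃ k, nbc i k ≠ nbc l k := by
      by_contra! hc
      exact h (nbc_injective (funext hc))
    refine Finset.prod_eq_zero (Finset.mem_univ k) ?_
    revert hk
    cases nbc i k <;> cases nbc l k <;> simp

lemma eq_sum_hadamard (X : Alphabet m N) (i : Fin (2 ^ m)) :
    X i = ∑ j, hadamardCoeff i j • hadamard X j := by
  simp only [hadamard, Finset.smul_sum, smul_smul]
  rw [Finset.sum_comm]
  have e : ∀ l, ∑ j, (hadamardCoeff i j * (1 / 2 ^ m * hadamardCoeff j l)) • X l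
      = if i = l then X l else 0 := by
    intro l
    rw [← Finset.sum_smul]
    have : ∑ j, hadamardCoeff i j * (1 / (2 : ℝ) ^ m * hadamardCoeff j l)
        = 1 / 2 ^ m * ∑ j, hadamardCoeff i j * hadamardCoeff j l := by
      rw [Finset.mul_sum]
      exact Finset.sum_congr rfl fun j _ => by ring
    rw [this, sum_hadamardCoeff_mul]
    split_ifs <;> simp
  simp only [e, Finset.sum_ite_eq, Finset.mem_univ, if_true]

/-- An affine alphabet combines only the columns `0` and `2 ^ k`, to which row `j` is orthogonal. -/
lemma hadamard_eq_zero_of_affine {X : Alphabet m N} (hX : IsAffineCube X) {j : Fin (2 ^ m)}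
    (h0 : j ≠ 0) (hj : ∀ k, j ≠ powIndex k) : hadamard X j = 0 := by
  obtain ⟨c, ℓ, h⟩ := hX
  have e : ∑ i, hadamardCoeff j i • X i
      = (∑ i, hadamardCoeff j i * hadamardCoeff i 0) • c
        + ∑ k, (∑ i, hadamardCoeff j i * hadamardCoeff i (powIndex k)) • ℓ k := by
    simp only [h, smul_add, Finset.sum_add_distrib, hadamardCoeff_zero, hadamardCoeff_powIndex,
      Finset.sum_smul, Finset.smul_sum, mul_one, smul_smul]
    rw [Finset.sum_comm]
  rw [hadamard, e]
  simp [sum_hadamardCoeff_mul, h0, hj]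

lemma isAffineCube_of_hadamard {X : Alphabet m N}
    (h : ∀ j : Fin (2 ^ m), j ≠ 0 → (∀ k, j ≠ powIndex k) → hadamard X j = 0) :
    IsAffineCube X := by
  refine ⟨hadamard X 0, fun k => hadamard X (powIndex k), fun i => ?_⟩
  have hinj : Function.Injective (powIndex : Fin m → Fin (2 ^ m)) := fun k l hkl =>
    Fin.ext (Nat.pow_right_injective le_rfl (congrArg Fin.val hkl))
  have h0 : (0 : Fin (2 ^ m)) ∉ Finset.univ.image (powIndex : Fin m → Fin (2 ^ m)) := by
    simp only [Finset.mem_image, Finset.mem_univ, true_and, not_exists]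
    intro k hk
    have := congrArg Fin.val hk
    simp [powIndex] at this
  rw [eq_sum_hadamard X i, ← Finset.sum_subset
    (Finset.subset_univ (insert 0 (Finset.univ.image powIndex)))]
  · rw [Finset.sum_insert h0, Finset.sum_image fun k _ l _ hkl => hinj hkl]
    simp [hadamardCoeff_zero, hadamardCoeff_powIndex]
  · intro j _ hj
    simp only [Finset.mem_insert, Finset.mem_image, Finset.mem_univ, true_and, not_or,
      not_exists] at hj
    rw [h j hj.1 fun k hk => hj.2 k hk.symm, smul_zero]

lemma hadamard_eq_zero_iff_isAffineCube (X : Alphabet m N) :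
    (∀ j : Fin (2 ^ m), j.val ∉ ({0} ∪ {l | ∃ k < m, l = 2 ^ k} : Set ℕ) → hadamard X j = 0) ↔
      IsAffineCube X := by
  have key : ∀ j : Fin (2 ^ m), j.val ∉ ({0} ∪ {l | ∃ k < m, l = 2 ^ k} : Set ℕ) ↔
      j ≠ 0 ∧ ∀ k, j ≠ powIndex k := by
    intro j
    simp only [Set.mem_union, Set.mem_singleton_iff, Set.mem_ofPred_eq, not_or, not_exists,
      not_and]
    refine and_congr (not_congr Fin.val_eq_zero_iff) ⟨fun h k hk => h k k.2 (congrArg Fin.val hk),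
      fun h k hk hj => h ⟨k, hk⟩ (Fin.ext hj)⟩
  simp only [key]
  exact ⟨fun h => isAffineCube_of_hadamard fun j h0 hj => h j ⟨h0, hj⟩,
    fun h j hj => hadamard_eq_zero_of_affine h hj.1 hj.2⟩

end Hadamard

-- Bit information as a difference of mixture entropies

section Channel

variable {m N : ℕ}

lemma hprod_smul (h : EuclideanSpace ℝ (Fin N)) (t : ℝ) (x : EuclideanSpace ℝ (Fin N)) :
    hprod h (t • x) = t • hprod h x := by
  ext n
  simp only [hprod, PiLp.smul_apply, smul_eq_mul]
  ring

lemma norm_hprod_sq (h x : EuclideanSpace ℝ (Fin N)) :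
    ‖hprod h x‖ ^ 2 = ∑ n, h n ^ 2 * x n ^ 2 := by
  simp [EuclideanSpace.real_norm_sq_eq, hprod, mul_pow]

lemma sum_smul_hprod {ι : Type*} [Fintype ι] (w : ι → ℝ) (h : EuclideanSpace ℝ (Fin N))
    (x : ι → EuclideanSpace ℝ (Fin N)) :
    ∑ i, w i • hprod h (x i) = hprod h (∑ i, w i • x i) := by
  ext n
  simp only [hprod, WithLp.ofLp_sum, WithLp.ofLp_smul, Finset.sum_apply, Pi.smul_apply,
    smul_eq_mul, Finset.mul_sum]
  exact Finset.sum_congr rfl fun i _ => by ring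

lemma continuous_hprod_left (x : EuclideanSpace ℝ (Fin N)) :
    Continuous fun h : EuclideanSpace ℝ (Fin N) => hprod h x := by
  unfold hprod; fun_prop

lemma chanPdf_eq (N0 : ℝ) (h x y : EuclideanSpace ℝ (Fin N)) :
    chanPdf N0 h x y = gaussPdf N0 y * likelihood N0 (hprod h x) y :=
  gaussPdf_sub N0 (hprod h x) y

lemma outPdf_eq (N0 : ℝ) (b : Fin m → ℝ) (X : Alphabet m N) (h y : EuclideanSpace ℝ (Fin N)) :
    outPdf N0 b X h y
      = gaussPdf N0 y * mixLikelihood N0 (symProb b) (fun i => hprod h (X i)) y := by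
  rw [outPdf, mixLikelihood, Finset.mul_sum]
  exact Finset.sum_congr rfl fun i _ => by rw [chanPdf_eq]; ring

lemma bitPdf_eq (N0 : ℝ) (b : Fin m → ℝ) (X : Alphabet m N) (k : Fin m) (u : Bool)
    (h y : EuclideanSpace ℝ (Fin N)) :
    bitPdf N0 b X k u h y
      = gaussPdf N0 y * mixLikelihood N0 (condProb b k u) (fun i => hprod h (X i)) y := by
  rw [bitPdf, mixLikelihood, Finset.mul_sum, Finset.sum_filter]
  refine Finset.sum_congr rfl fun i _ => ?_
  rw [condProb, chanPdf_eq]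
  split_ifs <;> ring

/-- The mutual information (in nats) between the bit `C_k` and the mixture of noise shifted by
the `a i`. -/
def bitInfo (N0 : ℝ) (b : Fin m → ℝ) (k : Fin m) (a : Alphabet m N) : ℝ :=
  ∑ u, bitProb b k u * mixEntropy N0 (condProb b k u) a - mixEntropy N0 (symProb b) a

variable {N0 : ℝ} {b : Fin m → ℝ}

lemma sum_bitProb_mul_mixLikelihood (hb : ∀ k, 0 < b k ∧ b k < 1) (k : Fin m)
    (a : Alphabet m N) (y : EuclideanSpace ℝ (Fin N)) :
    ∑ u, bitProb b k u * mixLikelihood N0 (condProb b k u) a y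
      = mixLikelihood N0 (symProb b) a y := by
  simp only [mixLikelihood, Finset.mul_sum]
  rw [Finset.sum_comm]
  refine Finset.sum_congr rfl fun i _ => ?_
  rw [← sum_bitProb_mul_condProb hb k i, Finset.sum_mul]
  exact Finset.sum_congr rfl fun u _ => by ring

/-- The conditional likelihood is at most the unconditional one divided by the bit probability, so
the cross term is dominated by a multiple of the integrable `|L log L|`. -/
lemma integrable_condMixLikelihood_mul_log (hN0 : 0 < N0) (hb : ∀ k, 0 < b k ∧ b k < 1)
    (k : Fin m) (u : Bool) (a : Alphabet m N) :
    Integrable fun y => gaussPdf N0 y * (mixLikelihood N0 (condProb b k u) a y *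
      Real.log (mixLikelihood N0 (symProb b) a y)) := by
  have hP := bitProb_pos hb k u
  refine (((integrable_mixLikelihood_mul_log hN0 (fun i => (symProb_pos hb i).le)
    (sum_symProb b) a).norm).const_mul (bitProb b k u)⁻¹).mono' ?_
    (Eventually.of_forall fun y => ?_)
  · exact ((continuous_gaussPdf N0).measurable.mul
      ((continuous_mixLikelihood N0 _ a).measurable.mul
        (continuous_mixLikelihood N0 _ a).measurable.log)).aestronglyMeasurable
  · have hg := gaussPdf_pos hN0 y
    have hLu := mixLikelihood_pos (N0 := N0) (condProb_nonneg hb k u) (sum_condProb hb k u) a y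
    have hL := mixLikelihood_pos (N0 := N0) (fun i => (symProb_pos hb i).le) (sum_symProb b) a y
    have hle : bitProb b k u * mixLikelihood N0 (condProb b k u) a y
        ≤ mixLikelihood N0 (symProb b) a y := by
      rw [← sum_bitProb_mul_mixLikelihood hb k]
      refine Finset.single_le_sum (f := fun u =>
        bitProb b k u * mixLikelihood N0 (condProb b k u) a y) (fun v _ => ?_) (Finset.mem_univ u)
      exact mul_nonneg (bitProb_pos hb k v).le
        (mixLikelihood_pos (condProb_nonneg hb k v) (sum_condProb hb k v) a y).le
    have hle' : mixLikelihood N0 (condProb b k u) a y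
        ≤ (bitProb b k u)⁻¹ * mixLikelihood N0 (symProb b) a y := by
      rw [inv_mul_eq_div, le_div_iff₀ hP, mul_comm]
      exact hle
    rw [norm_mul, norm_mul, norm_mul, norm_mul, Real.norm_of_nonneg hg.le,
      Real.norm_of_nonneg hLu.le, Real.norm_of_nonneg hL.le]
    calc gaussPdf N0 y * (mixLikelihood N0 (condProb b k u) a y *
          ‖Real.log (mixLikelihood N0 (symProb b) a y)‖)
        ≤ gaussPdf N0 y * ((bitProb b k u)⁻¹ * mixLikelihood N0 (symProb b) a y *
          ‖Real.log (mixLikelihood N0 (symProb b) a y)‖) := by gcongr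
      _ = _ := by ring

/-- The noise density cancels in the ratio, the logarithm splits, and the cross terms average over
the bit to the unconditional entropy. -/
lemma bitMI_integrand_eq (hN0 : 0 < N0) (hb : ∀ k, 0 < b k ∧ b k < 1) (X : Alphabet m N)
    (k : Fin m) (h : EuclideanSpace ℝ (Fin N)) :
    ∑ u : Bool, bitProb b k u * (∫ y, bitPdf N0 b X k u h y *
      Real.logb 2 (bitPdf N0 b X k u h y / outPdf N0 b X h y))
      = bitInfo N0 b k (fun i => hprod h (X i)) / Real.log 2 := by
  set a : Alphabet m N := fun i => hprod h (X i) with ha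
  set L := mixLikelihood N0 (symProb b) a with hL
  set Lu := fun u => mixLikelihood N0 (condProb b k u) a with hLu
  have hI1 : ∀ u, Integrable fun y => gaussPdf N0 y * (Lu u y * Real.log (Lu u y)) := fun u =>
    integrable_mixLikelihood_mul_log hN0 (condProb_nonneg hb k u) (sum_condProb hb k u) a
  have hI2 : ∀ u, Integrable fun y => gaussPdf N0 y * (Lu u y * Real.log (L y)) := fun u =>
    integrable_condMixLikelihood_mul_log hN0 hb k u a
  have e1 : ∀ u, ∫ y, bitPdf N0 b X k u h y *
      Real.logb 2 (bitPdf N0 b X k u h y / outPdf N0 b X h y)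
      = (mixEntropy N0 (condProb b k u) a
        - ∫ y, gaussPdf N0 y * (Lu u y * Real.log (L y))) / Real.log 2 := by
    intro u
    rw [mixEntropy, ← integral_sub (hI1 u) (hI2 u), ← integral_div]
    congr 1
    ext y
    have hg := gaussPdf_pos hN0 y
    have h1 : 0 < Lu u y := mixLikelihood_pos (condProb_nonneg hb k u) (sum_condProb hb k u) a y
    have h2 : 0 < L y := mixLikelihood_pos (fun i => (symProb_pos hb i).le) (sum_symProb b) a y
    rw [bitPdf_eq, outPdf_eq, Real.logb]
    change gaussPdf N0 y * Lu u y * (Real.log (gaussPdf N0 y * Lu u y / (gaussPdf N0 y * L y))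
      / Real.log 2) = (gaussPdf N0 y * (Lu u y * Real.log (Lu u y))
        - gaussPdf N0 y * (Lu u y * Real.log (L y))) / Real.log 2
    rw [mul_div_mul_left _ _ hg.ne', Real.log_div h1.ne' h2.ne']
    ring
  have e2 : ∑ u, bitProb b k u * ∫ y, gaussPdf N0 y * (Lu u y * Real.log (L y))
      = mixEntropy N0 (symProb b) a := by
    simp only [← integral_const_mul]
    rw [← integral_finsetSum _ fun u _ => (hI2 u).const_mul _, mixEntropy]
    congr 1
    ext y
    have hsum : ∑ u, bitProb b k u * Lu u y = L y := sum_bitProb_mul_mixLikelihood hb k a y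
    rw [← hL]
    nth_rw 2 [← hsum]
    rw [Finset.sum_mul, Finset.mul_sum]
    exact Finset.sum_congr rfl fun u _ => by ring
  simp only [e1, mul_div_assoc', mul_sub]
  rw [← Finset.sum_div, Finset.sum_sub_distrib, e2, bitInfo]

lemma gmi_smul (hN0 : 0 < N0) (hb : ∀ k, 0 < b k ∧ b k < 1)
    (ν : Measure (EuclideanSpace ℝ (Fin N))) (X : Alphabet m N) (t : ℝ) :
    gmi N0 ν b (fun i => t • X i)
      = ∑ k, ∫ h, bitInfo N0 b k (fun i => t • hprod h (X i)) / Real.log 2 ∂ν := by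
  unfold gmi bitMI
  simp only [bitMI_integrand_eq hN0 hb, hprod_smul]

lemma gmi_zero_smul (hN0 : 0 < N0) (hb : ∀ k, 0 < b k ∧ b k < 1)
    (ν : Measure (EuclideanSpace ℝ (Fin N))) (X : Alphabet m N) :
    gmi N0 ν b (fun i => (0 : ℝ) • X i) = 0 := by
  rw [gmi_smul hN0 hb]
  simp [bitInfo, mixEntropy, mixLikelihood, likelihood, sum_condProb hb, sum_symProb]

/-- Both terms of the difference lie between 0 and the right-hand side, by `mixEntropy_nonneg` and
`mixEntropy_le`. -/
lemma abs_bitInfo_le (hN0 : 0 < N0) (hb : ∀ k, 0 < b k ∧ b k < 1) (k : Fin m)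
    (a : Alphabet m N) : |bitInfo N0 b k a| ≤ ∑ i, symProb b i * (‖a i‖ ^ 2 / N0) := by
  have h1 : 0 ≤ mixEntropy N0 (symProb b) a :=
    mixEntropy_nonneg hN0 (fun i => (symProb_pos hb i).le) (sum_symProb b) a
  have h2 := mixEntropy_le hN0 (fun i => (symProb_pos hb i).le) (sum_symProb b) a
  have h3 : 0 ≤ ∑ u, bitProb b k u * mixEntropy N0 (condProb b k u) a :=
    Finset.sum_nonneg fun u _ => mul_nonneg (bitProb_pos hb k u).le
      (mixEntropy_nonneg hN0 (condProb_nonneg hb k u) (sum_condProb hb k u) a)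
  have h4 : ∑ u, bitProb b k u * mixEntropy N0 (condProb b k u) a
      ≤ ∑ i, symProb b i * (‖a i‖ ^ 2 / N0) := by
    calc _ ≤ ∑ u, bitProb b k u * ∑ i, condProb b k u i * (‖a i‖ ^ 2 / N0) :=
          Finset.sum_le_sum fun u _ => mul_le_mul_of_nonneg_left
            (mixEntropy_le hN0 (condProb_nonneg hb k u) (sum_condProb hb k u) a)
            (bitProb_pos hb k u).le
      _ = _ := by
          simp only [Finset.mul_sum]
          rw [Finset.sum_comm]
          refine Finset.sum_congr rfl fun i _ => ?_
          rw [← sum_bitProb_mul_condProb hb k i, Finset.sum_mul]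
          exact Finset.sum_congr rfl fun u _ => by ring
  rw [bitInfo, abs_le]
  constructor <;> linarith

lemma tendsto_bitInfo_smul_div_sq (hN0 : 0 < N0) (hb : ∀ k, 0 < b k ∧ b k < 1) (k : Fin m)
    (a : Alphabet m N) :
    Tendsto (fun t : ℝ => bitInfo N0 b k (fun i => t • a i) / t ^ 2) (𝓝[≠] 0)
      (𝓝 (∑ u, bitProb b k u * (‖∑ i, condProb b k u i • a i‖ ^ 2 / N0)
        - ‖∑ i, symProb b i • a i‖ ^ 2 / N0)) := by
  have h := (tendsto_finsetSum Finset.univ fun u _ =>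
    (tendsto_mixEntropy_smul_div_sq hN0 (condProb_nonneg hb k u)
      (sum_condProb hb k u) a).const_mul (bitProb b k u)).sub
    (tendsto_mixEntropy_smul_div_sq hN0 (fun i => (symProb_pos hb i).le) (sum_symProb b) a)
  refine h.congr fun t => ?_
  rw [bitInfo, sub_div, Finset.sum_div]
  simp only [mul_div_assoc]

lemma measurable_mixEntropy_hprod {ι : Type*} [Fintype ι] (N0 : ℝ) (w : ι → ℝ)
    (x : ι → EuclideanSpace ℝ (Fin N)) (t : ℝ) :
    Measurable fun h : EuclideanSpace ℝ (Fin N) =>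
      mixEntropy N0 w (fun i => t • hprod h (x i)) := by
  have hL : Continuous fun p : EuclideanSpace ℝ (Fin N) × EuclideanSpace ℝ (Fin N) =>
      mixLikelihood N0 w (fun i => t • hprod p.1 (x i)) p.2 := by
    unfold mixLikelihood likelihood
    refine continuous_finsetSum _ fun i _ => ?_
    have := (continuous_hprod_left (x i)).comp
      (continuous_fst (X := EuclideanSpace ℝ (Fin N)) (Y := EuclideanSpace ℝ (Fin N)))
    simp only [Function.comp_def] at this
    fun_prop
  have hF : Measurable fun p : EuclideanSpace ℝ (Fin N) × EuclideanSpace ℝ (Fin N) =>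
      gaussPdf N0 p.2 * (mixLikelihood N0 w (fun i => t • hprod p.1 (x i)) p.2 *
        Real.log (mixLikelihood N0 w (fun i => t • hprod p.1 (x i)) p.2)) :=
    ((continuous_gaussPdf N0).comp continuous_snd).measurable.mul
      (hL.measurable.mul hL.measurable.log)
  exact (hF.stronglyMeasurable.integral_prod_right' (ν := volume)).measurable

lemma measurable_bitInfo_hprod (N0 : ℝ) (b : Fin m → ℝ) (k : Fin m) (X : Alphabet m N) (t : ℝ) :
    Measurable fun h : EuclideanSpace ℝ (Fin N) =>
      bitInfo N0 b k (fun i => t • hprod h (X i)) := by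
  unfold bitInfo
  exact (Finset.measurable_sum _ fun u _ =>
    (measurable_mixEntropy_hprod N0 _ X t).const_mul _).sub (measurable_mixEntropy_hprod N0 _ X t)

end Channel

-- Averaging over the fading and the derivative at zero SNR

section Fading

variable {m N : ℕ} {N0 : ℝ} {b : Fin m → ℝ} {ν : Measure (EuclideanSpace ℝ (Fin N))}
  {ρ : Measure ℝ}

lemma integrable_coord_sq (hρ : ∀ n : Fin N, ν.map (fun h => h n) = ρ)
    (hρ_fin : Integrable (fun a : ℝ => a ^ 2) ρ) (n : Fin N) :
    Integrable (fun h : EuclideanSpace ℝ (Fin N) => h n ^ 2) ν := by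
  rw [← hρ n] at hρ_fin
  exact hρ_fin.comp_measurable (by fun_prop)

lemma integral_coord_sq (hρ : ∀ n : Fin N, ν.map (fun h => h n) = ρ) (n : Fin N) :
    ∫ h, h n ^ 2 ∂ν = ∫ a, a ^ 2 ∂ρ := by
  rw [← hρ n, integral_map (by fun_prop) (by fun_prop)]

/-- Only the squares `h n ^ 2` occur, with no cross products between components; this is why
dependence between the fading coefficients is harmless. -/
lemma bitInfo_limit_eq (N0 : ℝ) (b : Fin m → ℝ) (X : Alphabet m N) (k : Fin m)
    (h : EuclideanSpace ℝ (Fin N)) :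
    ∑ u, bitProb b k u * (‖∑ i, condProb b k u i • hprod h (X i)‖ ^ 2 / N0)
        - ‖∑ i, symProb b i • hprod h (X i)‖ ^ 2 / N0
      = ∑ n, h n ^ 2 * (condVar b (fun i => X i n) k / N0) := by
  simp only [sum_smul_hprod, norm_hprod_sq]
  have e1 : ∀ u n, (∑ i, condProb b k u i • X i) n = condExpect b k u fun i => X i n := by
    intro u n
    simp [condExpect_apply]
  have e2 : ∀ n, (∑ i, symProb b i • X i) n = expect b fun i => X i n := mean_apply b X
  simp only [e1, e2, condVar, Finset.sum_div, Finset.mul_sum]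
  rw [Finset.sum_comm, ← Finset.sum_sub_distrib]
  refine Finset.sum_congr rfl fun n _ => ?_
  rw [sub_div, mul_sub, Finset.sum_div, Finset.mul_sum]
  congr 1
  · exact Finset.sum_congr rfl fun u _ => by ring
  · ring

lemma tendsto_gmi_smul_div_sq (hN0 : 0 < N0) (hb : ∀ k, 0 < b k ∧ b k < 1)
    (hρ : ∀ n : Fin N, ν.map (fun h => h n) = ρ)
    (hρ_fin : Integrable (fun a : ℝ => a ^ 2) ρ) (X : Alphabet m N) :
    Tendsto (fun t : ℝ => gmi N0 ν b (fun i => t • X i) / t ^ 2) (𝓝[≠] 0)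
      (𝓝 ((∫ a, a ^ 2 ∂ρ) * bitEnergy b X / (N0 * Real.log 2))) := by
  have hlog : 0 < Real.log 2 := Real.log_pos one_lt_two
  have hcoord := integrable_coord_sq hρ hρ_fin
  have hk : ∀ k, Tendsto (fun t : ℝ => ∫ h, bitInfo N0 b k (fun i => t • hprod h (X i))
      / t ^ 2 / Real.log 2 ∂ν) (𝓝[≠] 0)
      (𝓝 (∫ h, (∑ n, h n ^ 2 * (condVar b (fun i => X i n) k / N0)) / Real.log 2 ∂ν)) := by
    intro k
    refine tendsto_integral_filter_of_dominated_convergence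
      -- The bound `abs_bitInfo_le` scales exactly like `t²`, so after division the majorant is
      -- independent of `t`.
      (fun h => (∑ i, symProb b i * ((∑ n, h n ^ 2 * X i n ^ 2) / N0)) / Real.log 2) ?_ ?_ ?_ ?_
    · exact Eventually.of_forall fun t => (((measurable_bitInfo_hprod N0 b k X t).div_const
        _).div_const _).aestronglyMeasurable
    · filter_upwards [self_mem_nhdsWithin] with t ht
      refine Eventually.of_forall fun h => ?_
      have ht0 : t ≠ 0 := ht
      have ht2 : 0 < t ^ 2 := by positivity
      rw [norm_div, norm_div, Real.norm_of_nonneg hlog.le, Real.norm_of_nonneg ht2.le]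
      gcongr
      rw [div_le_iff₀ ht2, Real.norm_eq_abs]
      refine (abs_bitInfo_le hN0 hb k _).trans (le_of_eq ?_)
      rw [Finset.sum_mul]
      refine Finset.sum_congr rfl fun i _ => ?_
      rw [norm_smul, mul_pow, norm_hprod_sq, Real.norm_eq_abs, sq_abs]
      ring
    · refine Integrable.div_const (integrable_finsetSum _ fun i _ => Integrable.const_mul ?_ _) _
      exact Integrable.div_const (integrable_finsetSum _ fun n _ => (hcoord n).mul_const _) _
    · refine Eventually.of_forall fun h => ?_
      have := tendsto_bitInfo_smul_div_sq hN0 hb k fun i => hprod h (X i)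
      rw [bitInfo_limit_eq] at this
      exact this.div_const _
  have hlim : ∑ k, ∫ h, (∑ n, h n ^ 2 * (condVar b (fun i => X i n) k / N0)) / Real.log 2 ∂ν
      = (∫ a, a ^ 2 ∂ρ) * bitEnergy b X / (N0 * Real.log 2) := by
    have e : ∀ k, ∫ h, (∑ n, h n ^ 2 * (condVar b (fun i => X i n) k / N0)) / Real.log 2 ∂ν
        = ∑ n, (∫ a, a ^ 2 ∂ρ) / (N0 * Real.log 2) * condVar b (fun i => X i n) k := by
      intro k
      rw [integral_div, integral_finsetSum _ fun n _ => (hcoord n).mul_const _, Finset.sum_div]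
      refine Finset.sum_congr rfl fun n _ => ?_
      rw [integral_mul_const, integral_coord_sq hρ]
      field_simp
    simp only [e]
    rw [Finset.sum_comm, bitEnergy, mul_div_right_comm, Finset.mul_sum]
    simp only [Finset.mul_sum]
  rw [← hlim]
  refine (tendsto_finsetSum Finset.univ fun k _ => hk k).congr fun t => ?_
  rw [gmi_smul hN0 hb, Finset.sum_div]
  refine Finset.sum_congr rfl fun k _ => ?_
  rw [← integral_div]
  congr 1
  ext h
  exact div_right_comm _ _ _

lemma energy_pos (hb : ∀ k, 0 < b k ∧ b k < 1) {X : Alphabet m N} (hX : X ≠ 0) :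
    0 < energy b X := by
  obtain ⟨i, hi⟩ := Function.ne_iff.1 hX
  refine Finset.sum_pos' (fun j _ => mul_nonneg (symProb_pos hb j).le (sq_nonneg _))
    ⟨i, Finset.mem_univ i, mul_pos (symProb_pos hb i) ?_⟩
  have : 0 < ‖X i‖ := norm_pos_iff.2 hi
  positivity

/-- The right derivative of the BICM mutual information at zero SNR. -/
lemma hasDerivWithinAt_gmiAtSNR (hN0 : 0 < N0) (hb : ∀ k, 0 < b k ∧ b k < 1)
    (hρ : ∀ n : Fin N, ν.map (fun h => h n) = ρ)
    (hρ_fin : Integrable (fun a : ℝ => a ^ 2) ρ) (hρ_pos : 0 < ∫ a, a ^ 2 ∂ρ)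
    {X : Alphabet m N} (hX : X ≠ 0) :
    HasDerivWithinAt (gmiAtSNR N0 ν ρ b X) (bitEnergy b X / energy b X / Real.log 2)
      (Set.Ici 0) 0 := by
  have hE := energy_pos hb hX
  have hlog : 0 < Real.log 2 := Real.log_pos one_lt_two
  set c := N0 / ((∫ a, a ^ 2 ∂ρ) * energy b X) with hc
  have hc0 : 0 < c := by positivity
  have e : ∀ s, s * N0 / ((∫ a, a ^ 2 ∂ρ) * energy b X) = c * s := fun s => by
    rw [hc]; ring
  have h0 : gmiAtSNR N0 ν ρ b X 0 = 0 := by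
    simp only [gmiAtSNR, zero_mul, zero_div, Real.sqrt_zero]
    exact gmi_zero_smul hN0 hb ν X
  rw [hasDerivWithinAt_iff_tendsto_slope, Set.Ici_sdiff_left]
  -- The amplitude at SNR `s` is `√(c * s)`, so a limit of `gmi / t²` becomes, up to the factor `c`,
  -- the slope in `s`.
  have hsqrt : Tendsto (fun s : ℝ => √(c * s)) (𝓝[>] 0) (𝓝[≠] 0) := by
    refine tendsto_nhdsWithin_iff.2 ⟨?_, ?_⟩
    · have : Continuous fun s : ℝ => √(c * s) := by fun_prop
      have := this.tendsto 0
      rw [mul_zero, Real.sqrt_zero] at this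
      exact this.mono_left nhdsWithin_le_nhds
    · filter_upwards [self_mem_nhdsWithin] with s hs
      exact (Real.sqrt_pos.2 (mul_pos hc0 hs)).ne'
  have hG := ((tendsto_gmi_smul_div_sq hN0 hb hρ hρ_fin X).comp hsqrt).mul_const c
  have elim : (∫ a, a ^ 2 ∂ρ) * bitEnergy b X / (N0 * Real.log 2) * c
      = bitEnergy b X / energy b X / Real.log 2 := by
    rw [hc]; field_simp
  rw [elim] at hG
  refine hG.congr' ?_
  filter_upwards [self_mem_nhdsWithin] with s hs
  have hs0 : (0 : ℝ) < s := hs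
  rw [slope_def_field, h0, sub_zero, sub_zero, gmiAtSNR, e]
  simp only [Function.comp_apply]
  rw [Real.sq_sqrt (by positivity)]
  field_simp

lemma isFOO_iff (hN0 : 0 < N0) (hb : ∀ k, 0 < b k ∧ b k < 1)
    (hρ : ∀ n : Fin N, ν.map (fun h => h n) = ρ)
    (hρ_fin : Integrable (fun a : ℝ => a ^ 2) ρ) (hρ_pos : 0 < ∫ a, a ^ 2 ∂ρ)
    {X : Alphabet m N} (hX : X ≠ 0) :
    IsFOO N0 ν ρ b X ↔ mean b X = 0 ∧ IsAffineCube X := by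
  have hd := hasDerivWithinAt_gmiAtSNR hN0 hb hρ hρ_fin hρ_pos hX
  have hE := energy_pos hb hX
  have hlog : 0 < Real.log 2 := Real.log_pos one_lt_two
  have hval : Real.logb 2 (Real.exp 1) = bitEnergy b X / energy b X / Real.log 2 ↔
      bitEnergy b X = energy b X := by
    rw [Real.logb, Real.log_exp, div_left_inj' hlog.ne', eq_comm, div_eq_one_iff_eq hE.ne']
  rw [← bitEnergy_eq_energy_iff hb, ← hval]
  refine ⟨fun h => ?_, fun h => ?_⟩
  · exact (uniqueDiffOn_Ici (0 : ℝ) 0 Set.self_mem_Ici).eq_deriv _ h hd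
  · rw [IsFOO, h]
    exact hd

/-- The mutual information is identically 0, with derivative 0. This excludes a zero `X'` in the
uniform characterization, where nonvanishing is not assumed. -/
lemma not_isFOO_zero (hN0 : 0 < N0) (hb : ∀ k, 0 < b k ∧ b k < 1) :
    ¬ IsFOO N0 ν ρ b (0 : Alphabet m N) := by
  intro h
  have e : gmiAtSNR N0 ν ρ b (0 : Alphabet m N) = fun _ => 0 := by
    ext s
    have := gmi_zero_smul hN0 hb ν (0 : Alphabet m N)
    simpa [gmiAtSNR] using this
  rw [IsFOO, e] at h
  have := (uniqueDiffOn_Ici (0 : ℝ) 0 Set.self_mem_Ici).eq_deriv _ h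
    (hasDerivWithinAt_const 0 _ (0 : ℝ))
  rw [Real.logb, Real.log_exp] at this
  have hlog : 0 < Real.log 2 := Real.log_pos one_lt_two
  exact (one_div_pos.2 hlog).ne' this

lemma exists_isFOO_uniform_iff (hN0 : 0 < N0)
    (hρ : ∀ n : Fin N, ν.map (fun h => h n) = ρ)
    (hρ_fin : Integrable (fun a : ℝ => a ^ 2) ρ) (hρ_pos : 0 < ∫ a, a ^ 2 ∂ρ)
    {X : Alphabet m N} (hX : X ≠ 0) :
    (∃ X' : Alphabet m N, IsFOO N0 ν ρ (uniformBits m) X' ∧ ∀ i, X i = X' i - mean b X') ↔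
      mean b X = 0 ∧ IsAffineCube X := by
  have hu : ∀ k, 0 < uniformBits m k ∧ uniformBits m k < 1 := fun k => by
    norm_num [uniformBits]
  constructor
  · rintro ⟨X', hX', h⟩
    have hne : X' ≠ 0 := by
      rintro rfl
      exact not_isFOO_zero hN0 hu hX'
    obtain rfl : X = fun i => X' i - mean b X' := funext h
    exact ⟨by rw [mean_sub_const, sub_self], isAffineCube_sub_const
      ((isFOO_iff hN0 hu hρ hρ_fin hρ_pos hne).1 hX').2 _⟩
  · rintro ⟨hm, hA⟩
    refine ⟨fun i => X i - mean (uniformBits m) X, ?_, fun i => ?_⟩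
    · refine (isFOO_iff hN0 hu hρ hρ_fin hρ_pos ?_).2
        ⟨by rw [mean_sub_const, sub_self], isAffineCube_sub_const hA _⟩
      -- If the recentred alphabet vanished, `X` would be constant; its mean under `b` is zero, so
      -- `X` itself would be zero.
      intro h0
      have hc : mean b (fun i => X i - mean (uniformBits m) X) = 0 := by
        rw [h0]; simp [mean]
      rw [mean_sub_const, hm, zero_sub, neg_eq_zero] at hc
      refine hX (funext fun i => ?_)
      have := congrFun h0 i
      simpa [hc] using this
    · rw [mean_sub_const, hm]
      simp

end Fading

end BICM

end

theorem theorem8 {m N : ℕ}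
    (b : Fin m → ℝ) (hb : ∀ k, 0 < b k ∧ b k < 1)
    (X : BICM.Alphabet m N) (hX : X ≠ 0)
    (ν : MeasureTheory.Measure (EuclideanSpace ℝ (Fin N)))
    (hν : MeasureTheory.IsProbabilityMeasure ν)
    (ρ : MeasureTheory.Measure ℝ)
    (hρ : ∀ n : Fin N, ν.map (fun h => h n) = ρ)
    (hρ_fin : MeasureTheory.Integrable (fun a : ℝ => a ^ 2) ρ)
    (hρ_pos : 0 < ∫ a, a ^ 2 ∂ρ)
    (N0 : ℝ) (hN0 : 0 < N0) :
    (BICM.IsFOO N0 ν ρ b X ↔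
      BICM.mean b X = 0 ∧
        ∀ j : Fin (2 ^ m), j.val ∉ ({0} ∪ {l | ∃ k < m, l = 2 ^ k} : Set ℕ) →
          BICM.hadamard X j = 0) ∧
    (BICM.IsFOO N0 ν ρ b X ↔
      ∃ L : EuclideanSpace ℝ (Fin m) →ₗ[ℝ] EuclideanSpace ℝ (Fin N),
        ∀ i, X i = L (BICM.vertex i) - BICM.mean b (fun j => L (BICM.vertex j))) ∧
    (BICM.IsFOO N0 ν ρ b X ↔
      ∃ X' : BICM.Alphabet m N, BICM.IsFOO N0 ν ρ (BICM.uniformBits m) X' ∧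
        ∀ i, X i = X' i - BICM.mean b X') := by
  have hN := BICM.isFOO_iff (ν := ν) hN0 hb hρ hρ_fin hρ_pos hX
  rw [BICM.hadamard_eq_zero_iff_isAffineCube, BICM.exists_linearMap_iff,
    BICM.exists_isFOO_uniform_iff hN0 hρ hρ_fin hρ_pos hX]
  exact ⟨hN, hN, hN⟩
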